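/- All Hilbert spaces are finite-dimensional and nonzero, and logarithms are in base 2. For positive semidefinite operators let $D(\rho\|\sigma)=\operatorname{Tr}[\rho(\log\rho-\log\sigma)]$ if $\operatorname{supp}\rho\subseteq\operatorname{supp}\sigma$ and $D(\rho\|\sigma)=+\infty$ otherwise, and for a bipartite state $\omega_{AB}$ let $I(A{:}B)_\omega=D(\omega_{AB}\|\omega_A\otimes\omega_B)$. Let $\mathcal N_{A\to B}$ be a quantum channel (a completely positive trace-preserving linear map) and let $\rho_{E_AE_B}$ be a bipartite state. For each state $\rho_A$ let $\varphi_{AA'}$, with $A'\cong A$, denote a purification of $\rho_A$. Define $$\chi(\mathcal N)=\max I(X{:}B)_\sigma,\qquad \sigma_{XB}=\sum_x p_X(x)|x\rangle\langle x|_X\otimes\mathcal N(\rho^x_A),$$ where the maximum is over all finite alphabets, probability distributions $p_X$ and families of states $\rho^x_A$; $$I(\mathcal N)=\max_{\rho_A} I(A'{:}B)_{\mathcal N_{A\to B}(\varphi_{AA'})};$$ $$\chi_\rho(\mathcal N)=\max I(X{:}BE_B)_\omega,\qquad I_\rho(\mathcal N)=\max I(XE_B{:}B)_\omega,$$ where both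 maxima are over all states $\omega_{XBE_B}=\sum_x p_X(x)|x\rangle\langle x|_X\otimes(\mathcal N_{A\to B}\circ\mathcal E^x_{E_A\to A})(\rho_{E_AE_B})$, with a finite alphabet, a probability distribution $p_X$ and quantum channels $\mathcal E^x_{E_A\to A}$. Then all these maxima are attained; the quantity $I(\mathcal N)$ does not depend on the choice of the purifications; and \begin{align*} \chi(\mathcal N)&=\min_{\sigma_B}\max_{\rho_A} D\big(\mathcal N(\rho_A)\,\big\|\,\sigma_B\big),\\ I(\mathcal N)&=\min_{\sigma_B}\max_{\rho_A} D\big(\mathcal N_{A\to B}(\varphi_{AA'})\,\big\|\,\sigma_B\otimes\varphi_{A'}\big),\\ \chi_\rho(\mathcal N)&=\min_{\sigma_{BE_B}}\max_{\mathcal E_{E_A\to A}} D\big(\mathcal N\circ\mathcal E(\rho_{E_AE_B})\,\big\|\,\sigma_{BE_B}\big),\\ I_\rho(\mathcal N)&=\min_{\sigma_B}\max_{\mathcal E_{E_A\to A}} D\big(\mathcal N\circ\mathcal E(\rho_{E_AE_B})\,\big\|\,\sigma_B\otimes\rho_{E_B}\big), \end{align*} where the minima are over all states, $\mathcal E$ ranges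 over all quantum channels from $E_A$ to $A$, and all minima and maxima (the inner maxima possibly being $+\infty$) are attained. -/

import Mathlib

open scoped Kronecker ComplexOrder

noncomputable section

namespace QInfo

universe u v w

/-- Density operators on the finite-dimensional Hilbert space with orthonormal basis indexed
by `n`: positive semidefinite matrices of trace one. -/
structure State (n : Type u) [Fintype n] where
  mat : Matrix n n ℂ
  posSemidef : mat.PosSemidef
  trace_eq_one : mat.trace = 1

/-- Marginal of an operator on the first tensor factor (the second one is traced out). -/
def marginalFst {m : Type u} {n : Type v} [Fintype n] (M : Matrix (m × n) (m × n) ℂ) :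
    Matrix m m ℂ :=
  fun i i' => ∑ j, M (i, j) (i', j)

/-- Marginal of an operator on the second tensor factor (the first one is traced out). -/
def marginalSnd {m : Type u} {n : Type v} [Fintype m] (M : Matrix (m × n) (m × n) ℂ) :
    Matrix n n ℂ :=
  fun j j' => ∑ i, M (i, j) (i, j')

/-- The map `N ⊗ id_R`, applied to an operator on `A ⊗ R`: apply `N` to each block
`(⟨r| M |r'⟩)` of `M`. -/
def tensorId {a : Type u} {b : Type v} {r : Type w}
    (N : Matrix a a ℂ →ₗ[ℂ] Matrix b b ℂ) (M : Matrix (a × r) (a × r) ℂ) :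
    Matrix (b × r) (b × r) ℂ :=
  fun p q => N (fun i i' => M (i, p.2) (i', q.2)) p.1 q.1

/-- Quantum channels: completely positive trace-preserving linear maps. -/
structure Channel (a : Type u) (b : Type v) [Fintype a] [Fintype b] where
  map : Matrix a a ℂ →ₗ[ℂ] Matrix b b ℂ
  completelyPositive : ∀ (k : ℕ) (M : Matrix (a × Fin k) (a × Fin k) ℂ),
    M.PosSemidef → (tensorId map M).PosSemidef
  tracePreserving : ∀ M : Matrix a a ℂ, (map M).trace = M.trace

/-- The binary logarithm of a Hermitian matrix, by functional calculus (it is `0` on the kernel,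
which gives the convention `0 log 0 = 0`). -/
def log2 {n : Type u} [Fintype n] [DecidableEq n] (M : Matrix n n ℂ) : Matrix n n ℂ :=
  cfc (Real.logb 2) M

open Classical in
/-- Quantum relative entropy `D(ρ‖σ)` of positive semidefinite matrices, in bits. It is
`Tr[ρ (log ρ - log σ)]` if `supp ρ ⊆ supp σ`, i.e. `ker σ ⊆ ker ρ`, and `+∞` otherwise. -/
def relEntropy {n : Type u} [Fintype n] [DecidableEq n] (ρ σ : Matrix n n ℂ) : EReal :=
  if ∀ v : n → ℂ, σ.mulVec v = 0 → ρ.mulVec v = 0 then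
    (((ρ * (log2 ρ - log2 σ)).trace.re : ℝ) : EReal)
  else ⊤

/-- Quantum mutual information `I(A:B)` of a bipartite state: `D(ρ_AB ‖ ρ_A ⊗ ρ_B)`. -/
def mutualInformation {m : Type u} {n : Type v} [Fintype m] [DecidableEq m] [Fintype n]
    [DecidableEq n] (ω : Matrix (m × n) (m × n) ℂ) : EReal :=
  relEntropy ω (marginalFst ω ⊗ₖ marginalSnd ω)

/-- Probability distributions on the alphabet `{0, …, k-1}`. -/
def IsDistribution {k : ℕ} (p : Fin k → ℝ) : Prop :=
  (∀ x, 0 ≤ p x) ∧ ∑ x, p x = 1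

/-- The classical-quantum operator `∑ₓ p(x) |x⟩⟨x| ⊗ ω^x` on `X ⊗ M`. -/
def cqState {k : ℕ} {m : Type u} (p : Fin k → ℝ) (ω : Fin k → Matrix m m ℂ) :
    Matrix (Fin k × m) (Fin k × m) ℂ :=
  ∑ x, (p x : ℂ) • (Matrix.single x x (1 : ℂ) ⊗ₖ ω x)

/-- Regroup the tensor factors `X ⊗ (B ⊗ E)` as `(X ⊗ E) ⊗ B`. -/
def regroup (x : Type u) (b : Type v) (e : Type w) : x × (b × e) ≃ (x × e) × b where
  toFun t := ((t.1, t.2.2), t.2.1)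
  invFun t := (t.1.1, (t.2, t.1.2))
  left_inv _ := rfl
  right_inv _ := rfl

section Purification

variable {a : Type u} [Fintype a]

/-- `φ` on `A ⊗ A'`, with `A' ≅ A`, is a purification of `ρ` on `A`: it is a pure state
`|ψ⟩⟨ψ|` with marginal `ρ` on `A`. -/
def IsPurification (φ : State (a × a)) (ρ : State a) : Prop :=
  (∃ ψ : a × a → ℂ, φ.mat = Matrix.vecMulVec ψ (star ψ)) ∧ marginalFst φ.mat = ρ.mat

/-- The vector `(√ρ ⊗ 1) ∑ᵢ |i⟩|i⟩` of `A ⊗ A'`. -/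
def purifyingVector [DecidableEq a] (ρ : State a) : a × a → ℂ :=
  fun t => cfc Real.sqrt ρ.mat t.1 t.2

theorem marginalFst_purifyingVector [DecidableEq a] (ρ : State a) :
    marginalFst (Matrix.vecMulVec (purifyingVector ρ) (star (purifyingVector ρ))) = ρ.mat := by
  have hs : (cfc Real.sqrt ρ.mat).conjTranspose = cfc Real.sqrt ρ.mat :=
    (cfc_predicate Real.sqrt ρ.mat : IsSelfAdjoint _)
  have hsq : cfc Real.sqrt ρ.mat * (cfc Real.sqrt ρ.mat).conjTranspose = ρ.mat := by
    rw [hs, ← cfc_mul Real.sqrt Real.sqrt ρ.mat]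
    have hsa : IsSelfAdjoint ρ.mat := ρ.posSemidef.1
    conv_rhs => rw [← cfc_id ℝ ρ.mat hsa]
    refine cfc_congr fun x hx => ?_
    have hx' := hx
    rw [ρ.posSemidef.1.spectrum_real_eq_range_eigenvalues] at hx'
    obtain ⟨i, rfl⟩ := hx'
    exact Real.mul_self_sqrt (ρ.posSemidef.eigenvalues_nonneg i)
  ext i k
  have := congrFun (congrFun hsq i) k
  rw [← this]
  simp [marginalFst, Matrix.vecMulVec_apply, purifyingVector, Matrix.mul_apply,
    Matrix.conjTranspose_apply]

/-- The canonical purification of a state. -/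
def purify [DecidableEq a] (ρ : State a) : State (a × a) where
  mat := Matrix.vecMulVec (purifyingVector ρ) (star (purifyingVector ρ))
  posSemidef := Matrix.posSemidef_vecMulVec_self_star _
  trace_eq_one := by
    rw [← ρ.trace_eq_one]
    conv_rhs => rw [← marginalFst_purifyingVector ρ]
    simp [Matrix.trace, marginalFst, Fintype.sum_prod_type]

theorem isPurification_purify [DecidableEq a] (ρ : State a) : IsPurification (purify ρ) ρ :=
  ⟨⟨purifyingVector ρ, rfl⟩, marginalFst_purifyingVector ρ⟩

end Purification

section Information

variable {a : Type*} {b : Type*} {ea : Type*} {eb : Type*}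
  [Fintype a] [Fintype b] [DecidableEq b] [Fintype ea] [Fintype eb] [DecidableEq eb]

/-- The values `I(X:B)` over all states `∑ₓ p(x) |x⟩⟨x| ⊗ N(ρ^x)`, for all finite alphabets. -/
def holevoValues (N : Channel a b) : Set EReal :=
  {v | ∃ (k : ℕ) (p : Fin k → ℝ) (ρ : Fin k → State a), IsDistribution p ∧
    v = mutualInformation (cqState p fun x => N.map (ρ x).mat)}

/-- The Holevo information `χ(N)`. -/
def holevoInformation (N : Channel a b) : EReal := sSup (holevoValues N)

/-- The mutual information `I(N|ρ)` of a channel with respect to an input state. -/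
def mutualInformationAt [DecidableEq a] (N : Channel a b) (ρ : State a) : EReal :=
  mutualInformation (tensorId N.map (purify ρ).mat)

/-- The mutual information `I(N)` of a channel. -/
def channelMutualInformation [DecidableEq a] (N : Channel a b) : EReal :=
  sSup (Set.range (mutualInformationAt N))

/-- The state `N ∘ E (ρ)` on `B ⊗ E_B`, with `N ∘ E` acting on the first factor of `ρ`. -/
def encodedOutput (N : Channel a b) (ρ : State (ea × eb)) (E : Channel ea a) :
    Matrix (b × eb) (b × eb) ℂ :=
  tensorId (N.map ∘ₗ E.map) ρ.mat

/-- The values `I(X:BE_B)` over all states `∑ₓ p(x) |x⟩⟨x| ⊗ N ∘ E^x (ρ)`. -/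
def assistedHolevoValues (N : Channel a b) (ρ : State (ea × eb)) : Set EReal :=
  {v | ∃ (k : ℕ) (p : Fin k → ℝ) (E : Fin k → Channel ea a), IsDistribution p ∧
    v = mutualInformation (cqState p fun x => encodedOutput N ρ (E x))}

/-- The `ρ`-assisted Holevo information `χ_ρ(N)`. -/
def assistedHolevoInformation (N : Channel a b) (ρ : State (ea × eb)) : EReal :=
  sSup (assistedHolevoValues N ρ)

/-- The values `I(XE_B:B)` over all states `∑ₓ p(x) |x⟩⟨x| ⊗ N ∘ E^x (ρ)`. -/
def assistedMutualValues (N : Channel a b) (ρ : State (ea × eb)) : Set EReal :=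
  {v | ∃ (k : ℕ) (p : Fin k → ℝ) (E : Fin k → Channel ea a), IsDistribution p ∧
    v = mutualInformation (Matrix.reindex (regroup (Fin k) b eb) (regroup (Fin k) b eb)
      (cqState p fun x => encodedOutput N ρ (E x)))}

/-- The `ρ`-assisted mutual information `I_ρ(N)`. -/
def assistedMutualInformation (N : Channel a b) (ρ : State (ea × eb)) : EReal :=
  sSup (assistedMutualValues N ρ)

end Information

/-- `v = min_s max_t f s t`, where each maximum (possibly `+∞`) and the minimum are attained. -/
def IsMinMax {S : Type u} {T : Type v} (f : S → T → EReal) (x : EReal) : Prop :=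
  ∃ g : S → EReal, (∀ s, IsGreatest (Set.range (f s)) (g s)) ∧ IsLeast (Set.range g) x

end QInfo

end

/-! All four identities are instances of one minimax statement, `ensemble_isMinMax`. Let F(t) be
states and h(t) real numbers such that the set of pairs (F(t), h(t)) is compact. Finite ensembles
correspond to points y of its convex hull, which is compact by Carathéodory, and the information
quantity becomes the continuous function y₂ + S(y₁), where S = -`negEntropy`. Let z be a maximiser,
with value M. No general minimax theorem is needed, because σ = z₁ is itself optimal. Moving from z
towards (F(t), h(t)) cannot increase the function, and Klein's inequality together with lower
semicontinuity of D turns this first-order condition into h(t) + S(F(t)) + D(F(t)‖z₁) ≤ M for every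
t. Conversely, for any σ, averaging the same expression over the ensemble of z and applying Klein's
inequality gives at least M.

For χ and χ_ρ one takes h = -S(F). For I_ρ, the identity D(ω‖σ ⊗ τ) = I(ω) + D(ω_B‖σ) + D(ω_E‖τ)
(`relEntropy_kronecker`) leaves only the B marginal as F, and h = S(E_B) - S(BE_B). Compactness
holds because states and channels form compact sets.

For I(N) the mutual information of a purified input is S(A) + S(B) - S(E), with E the environment of
N. Here h = S(A) - S(E), and the maximum over ensembles must collapse to a maximum over single
states. This is concavity of h in the input state, which follows from monotonicity of the relative
entropy under the channel to E. That monotonicity is derived from a variational integral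
representation of D and a Schwarz inequality for Kraus maps. -/

set_option linter.unusedSectionVars false

noncomputable section

namespace QInfo

universe u v w

open Matrix Filter Topology

/-! ### Spectral calculus, supports and entropy in an eigenbasis. -/

section Spectral

variable {m : Type u} {n : Type v} [Fintype m] [DecidableEq m] [Fintype n] [DecidableEq n]

/-- The diagonal matrix with real entries `d`. -/
abbrev rdiag (d : n → ℝ) : Matrix n n ℂ := diagonal fun i => (d i : ℂ)

/-- The map d ↦ U diag(d) Uᴴ is a homomorphism of real algebras, so the spectrum lies in the range
of d. There f agrees with a Lagrange interpolation polynomial, and polynomials commute with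
homomorphisms. Any diagonalisation may thus be used, in particular product and block ones. -/
theorem cfc_conj_rdiag (U : Matrix m n ℂ) (h1 : Uᴴ * U = 1) (h2 : U * Uᴴ = 1) (d : n → ℝ)
    (f : ℝ → ℝ) : cfc f (U * rdiag d * Uᴴ) = U * rdiag (fun i => f (d i)) * Uᴴ := by
  let ψ : (n → ℝ) →ₐ[ℝ] Matrix m m ℂ := AlgHom.ofLinearMap
    { toFun := fun d => U * rdiag d * Uᴴ
      map_add' := fun x y => by
        have : rdiag (x + y) = rdiag x + rdiag y := by
          ext i j; by_cases h : i = j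
          · subst h; simp
          · simp [h]
        rw [this, Matrix.mul_add, Matrix.add_mul]
      map_smul' := fun r x => by
        have : rdiag (r • x) = r • rdiag x := by
          ext i j; by_cases h : i = j
          · subst h; simp
          · simp [h]
        rw [this]; simp }
    (by
      have : rdiag (1 : n → ℝ) = 1 := by simp [rdiag]
      change U * rdiag (1 : n → ℝ) * Uᴴ = 1
      rw [this, Matrix.mul_one, h2])
    (fun x y => by
      change U * rdiag (x * y) * Uᴴ = U * rdiag x * Uᴴ * (U * rdiag y * Uᴴ)
      have : rdiag (x * y) = rdiag x * rdiag y := by rw [diagonal_mul_diagonal]; simp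
      rw [this]
      calc U * (rdiag x * rdiag y) * Uᴴ = U * rdiag x * (1 : Matrix n n ℂ) * rdiag y * Uᴴ := by
            simp only [Matrix.mul_one, Matrix.mul_assoc]
        _ = _ := by rw [← h1]; simp only [Matrix.mul_assoc])
  have hψ (d : n → ℝ) : ψ d = U * rdiag d * Uᴴ := rfl
  have hherm : (ψ d).IsHermitian := by
    rw [hψ, IsHermitian, conjTranspose_mul, conjTranspose_mul, conjTranspose_conjTranspose,
      diagonal_conjTranspose, Matrix.mul_assoc]
    congr 3
    ext i
    simp
  have hsp : spectrum ℝ (ψ d) ⊆ Set.range d := by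
    refine (AlgHom.spectrum_apply_subset ψ d).trans ?_
    rw [Pi.spectrum_eq]
    intro x hx
    obtain ⟨i, hi⟩ := Set.mem_iUnion.1 hx
    rw [← Algebra.algebraMap_self_apply (d i), spectrum.scalar_eq] at hi
    exact ⟨i, hi.symm⟩
  let s : Finset ℝ := Finset.univ.image d
  let p := Lagrange.interpolate s id f
  have hp (x : ℝ) (hx : x ∈ Set.range d) : p.eval x = f x := by
    refine Lagrange.eval_interpolate_at_node (v := id) f Function.injective_id.injOn ?_
    simp only [s, Finset.mem_image, Finset.mem_univ, true_and]
    exact hx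
  rw [← hψ, ← hψ]
  calc cfc f (ψ d) = cfc p.eval (ψ d) := cfc_congr fun x hx => (hp x (hsp hx)).symm
    _ = Polynomial.aeval (ψ d) p := cfc_polynomial p _ hherm
    _ = ψ (Polynomial.aeval d p) := (Polynomial.aeval_algHom_apply ψ d p)
    _ = _ := by
      congr 1; ext i
      rw [← hp (d i) ⟨i, rfl⟩]
      simp

theorem exists_unitary_rdiag {A : Matrix n n ℂ} (hA : A.IsHermitian) :
    ∃ (U : Matrix n n ℂ) (d : n → ℝ), Uᴴ * U = 1 ∧ U * Uᴴ = 1 ∧ A = U * rdiag d * Uᴴ :=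
  ⟨hA.eigenvectorUnitary, hA.eigenvalues, Unitary.coe_star_mul_self hA.eigenvectorUnitary,
    Unitary.coe_mul_star_self hA.eigenvectorUnitary, hA.spectral_theorem⟩

theorem exists_unitary_rdiag_nonneg {A : Matrix n n ℂ} (hA : A.PosSemidef) :
    ∃ (U : Matrix n n ℂ) (d : n → ℝ), Uᴴ * U = 1 ∧ U * Uᴴ = 1 ∧ A = U * rdiag d * Uᴴ ∧
      ∀ i, 0 ≤ d i :=
  ⟨hA.1.eigenvectorUnitary, hA.1.eigenvalues, Unitary.coe_star_mul_self hA.1.eigenvectorUnitary,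
    Unitary.coe_mul_star_self hA.1.eigenvectorUnitary, hA.1.spectral_theorem,
    hA.eigenvalues_nonneg⟩

theorem re_trace_mul_conj_rdiag (A : Matrix m m ℂ) (U : Matrix m n ℂ) (g : n → ℝ) :
    (A * (U * rdiag g * Uᴴ)).trace.re = ∑ j, ((Uᴴ * A * U) j j).re * g j := by
  have : (A * (U * rdiag g * Uᴴ)).trace = ((Uᴴ * A * U) * rdiag g).trace := by
    rw [← Matrix.mul_assoc, trace_mul_comm, ← Matrix.mul_assoc, ← Matrix.mul_assoc]
  rw [this, trace, Complex.re_sum]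
  simp [mul_diagonal]

theorem conj_rdiag_apply (U : Matrix m n ℂ) (d : n → ℝ) (i : m) :
    (U * rdiag d * Uᴴ) i i = ((∑ j, ‖U i j‖ ^ 2 * d j : ℝ) : ℂ) := by
  rw [mul_apply]
  push_cast
  refine Finset.sum_congr rfl fun j _ => ?_
  rw [mul_diagonal, conjTranspose_apply, mul_right_comm]
  congr 1
  exact Complex.mul_conj' _

/-- `Re Tr(A log₂ B)`. -/
def trLog (A B : Matrix n n ℂ) : ℝ := (A * log2 B).trace.re

/-- `Re Tr(A log₂ A)`. -/
def negEntropy (A : Matrix n n ℂ) : ℝ := trLog A A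

/-- `supp ρ ⊆ supp σ`, that is `ker σ ⊆ ker ρ`. -/
def SuppLE (ρ σ : Matrix n n ℂ) : Prop := ∀ v : n → ℂ, σ *ᵥ v = 0 → ρ *ᵥ v = 0

theorem relEntropy_of_suppLE {ρ σ : Matrix n n ℂ} (h : SuppLE ρ σ) :
    relEntropy ρ σ = ((negEntropy ρ - trLog ρ σ : ℝ) : EReal) := by
  rw [relEntropy, if_pos (by exact h), negEntropy, trLog, trLog, mul_sub, trace_sub, Complex.sub_re]

theorem relEntropy_of_not_suppLE {ρ σ : Matrix n n ℂ} (h : ¬ SuppLE ρ σ) :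
    relEntropy ρ σ = ⊤ := if_neg h

theorem log2_conj_rdiag (U : Matrix m n ℂ) (h1 : Uᴴ * U = 1) (h2 : U * Uᴴ = 1) (d : n → ℝ) :
    log2 (U * rdiag d * Uᴴ) = U * rdiag (fun i => Real.logb 2 (d i)) * Uᴴ :=
  cfc_conj_rdiag U h1 h2 d _

theorem trLog_conj_rdiag (A : Matrix m m ℂ) (U : Matrix m n ℂ) (h1 : Uᴴ * U = 1)
    (h2 : U * Uᴴ = 1) (d : n → ℝ) :
    trLog A (U * rdiag d * Uᴴ) = ∑ j, ((Uᴴ * A * U) j j).re * Real.logb 2 (d j) := by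
  rw [trLog, log2_conj_rdiag U h1 h2, re_trace_mul_conj_rdiag]

theorem conj_conj_rdiag (U : Matrix m n ℂ) (h1 : Uᴴ * U = 1) (d : n → ℝ) :
    Uᴴ * (U * rdiag d * Uᴴ) * U = rdiag d := by
  calc Uᴴ * (U * rdiag d * Uᴴ) * U = (Uᴴ * U) * rdiag d * (Uᴴ * U) := by
        simp only [Matrix.mul_assoc]
    _ = _ := by rw [h1, one_mul, mul_one]

theorem negEntropy_conj_rdiag (U : Matrix m n ℂ) (h1 : Uᴴ * U = 1) (h2 : U * Uᴴ = 1)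
    (d : n → ℝ) : negEntropy (U * rdiag d * Uᴴ) = ∑ j, d j * Real.logb 2 (d j) := by
  rw [negEntropy, trLog_conj_rdiag _ U h1 h2, conj_conj_rdiag U h1]
  simp

/-- For positive semidefinite A, ⟨u, Au⟩ = 0 forces Au = 0, so inclusion of supports can be read off
from the diagonal weights of A in the eigenbasis of the second argument. -/
theorem suppLE_conj_rdiag_iff {A : Matrix m m ℂ} (hA : A.PosSemidef) (U : Matrix m n ℂ)
    (h1 : Uᴴ * U = 1) (h2 : U * Uᴴ = 1) (d : n → ℝ) :
    SuppLE A (U * rdiag d * Uᴴ) ↔ ∀ j, d j = 0 → ((Uᴴ * A * U) j j).re = 0 := by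
  have key (j : n) : (Uᴴ * A * U) j j = star (U.col j) ⬝ᵥ (A *ᵥ U.col j) := by
    rw [Matrix.mul_assoc, mul_apply]
    simp only [dotProduct, mulVec, mul_apply, conjTranspose_apply, Pi.star_apply, col_apply]
  constructor
  · intro h j hj
    have : (U * rdiag d * Uᴴ) *ᵥ U.col j = 0 := by
      have hc : U.col j = U *ᵥ Pi.single j 1 := by simp
      rw [hc, mulVec_mulVec, Matrix.mul_assoc, h1, Matrix.mul_one, ← mulVec_mulVec,
        diagonal_mulVec_single, hj]
      simp
    rw [key, h _ this]
    simp
  · intro h v hv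
    have hz (j : n) : d j = 0 ∨ (Uᴴ *ᵥ v) j = 0 := by
      have : rdiag d *ᵥ (Uᴴ *ᵥ v) = 0 := by
        have := congrArg (fun w => Uᴴ *ᵥ w) hv
        simp only [mulVec_mulVec, mulVec_zero] at this ⊢
        rw [← this]
        congr 1
        calc rdiag d * Uᴴ = 1 * rdiag d * Uᴴ := by rw [one_mul]
          _ = _ := by rw [← h1]; simp only [Matrix.mul_assoc]
      have := congrFun this j
      simpa [mulVec_diagonal] using this
    have hv' : v = U *ᵥ (Uᴴ *ᵥ v) := by rw [mulVec_mulVec, h2, one_mulVec]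
    rw [hv', mulVec_mulVec, mulVec_eq_sum]
    refine Finset.sum_eq_zero fun j _ => ?_
    rcases hz j with hj | hj
    · have h0 : star (U.col j) ⬝ᵥ (A *ᵥ U.col j) = 0 := by
        have h3 := h j hj
        rw [key] at h3
        have h4 := (hA.dotProduct_mulVec_nonneg (U.col j))
        apply Complex.ext h3
        exact (Complex.le_def.1 h4).2.symm
      have := (hA.dotProduct_mulVec_zero_iff _).1 h0
      have h5 : (A * U)ᵀ j = A *ᵥ U.col j := by
        ext i; simp [mulVec, dotProduct, mul_apply]
      change _ • (A * U)ᵀ j = 0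
      rw [h5, this, smul_zero]
    · rw [hj]; simp

theorem conj_diag_re_nonneg {A : Matrix m m ℂ} (hA : A.PosSemidef) (U : Matrix m n ℂ) (j : n) :
    0 ≤ ((Uᴴ * A * U) j j).re :=
  (Complex.le_def.1 (hA.conjTranspose_mul_mul_same U).diag_nonneg).1

theorem SuppLE.refl (A : Matrix n n ℂ) : SuppLE A A := fun _ h => h

theorem SuppLE.add_right {A B : Matrix n n ℂ} (hA : A.PosSemidef) (hB : B.PosSemidef) :
    SuppLE A (A + B) := by
  intro v hv
  rw [← hA.dotProduct_mulVec_zero_iff]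
  have h : star v ⬝ᵥ (A *ᵥ v) + star v ⬝ᵥ (B *ᵥ v) = 0 := by
    rw [← dotProduct_add, ← add_mulVec, hv, dotProduct_zero]
  have h1 := hA.dotProduct_mulVec_nonneg v
  have h2 := hB.dotProduct_mulVec_nonneg v
  exact le_antisymm (by rw [← h]; exact le_add_of_nonneg_right h2) h1

/-- Entropy is a function of the characteristic polynomial alone. Invariance under transposition and
reindexing, and the equality for X Xᴴ and Xᴴ X, then come from the same facts about characteristic
polynomials. -/
theorem negEntropy_eq_sum_roots {A : Matrix n n ℂ} (hA : A.IsHermitian) :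
    negEntropy A = (A.charpoly.roots.map fun z => z.re * Real.logb 2 z.re).sum := by
  rw [hA.roots_charpoly_eq_eigenvalues]
  conv_lhs => rw [show A = _ from hA.spectral_theorem]
  refine (negEntropy_conj_rdiag _ (Unitary.coe_star_mul_self hA.eigenvectorUnitary)
    (Unitary.coe_mul_star_self hA.eigenvectorUnitary) hA.eigenvalues).trans ?_
  simp

theorem negEntropy_mul_conjTranspose_comm (X : Matrix n n ℂ) :
    negEntropy (X * Xᴴ) = negEntropy (Xᴴ * X) := by
  rw [negEntropy_eq_sum_roots (isHermitian_mul_conjTranspose_self X),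
    negEntropy_eq_sum_roots (isHermitian_conjTranspose_mul_self X), charpoly_mul_comm]

theorem negEntropy_transpose {A : Matrix n n ℂ} (hA : A.IsHermitian) :
    negEntropy Aᵀ = negEntropy A := by
  rw [negEntropy_eq_sum_roots hA, negEntropy_eq_sum_roots hA.transpose, charpoly_transpose]

theorem negEntropy_submatrix {A : Matrix n n ℂ} (hA : A.IsHermitian) (e : m ≃ n) :
    negEntropy (A.submatrix e e) = negEntropy A := by
  rw [negEntropy_eq_sum_roots hA, negEntropy_eq_sum_roots (hA.submatrix e)]
  congr 3
  exact charpoly_reindex e.symm A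

end Spectral

/-! ### Relative entropy to a product operator. -/

section Tensor

variable {m : Type u} {n : Type v} [Fintype m] [DecidableEq m] [Fintype n] [DecidableEq n]

theorem trace_mul_kronecker_one (ω : Matrix (m × n) (m × n) ℂ) (X : Matrix m m ℂ) :
    (ω * (X ⊗ₖ (1 : Matrix n n ℂ))).trace = (marginalFst ω * X).trace := by
  simp only [trace, diag, mul_apply, marginalFst, kroneckerMap_apply, Fintype.sum_prod_type,
    one_apply, mul_ite, mul_one, mul_zero, Finset.sum_ite_eq', Finset.mem_univ, if_true,
    Finset.sum_mul]
  refine Finset.sum_congr rfl fun i _ => ?_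
  exact Finset.sum_comm

theorem trace_mul_one_kronecker (ω : Matrix (m × n) (m × n) ℂ) (Y : Matrix n n ℂ) :
    (ω * ((1 : Matrix m m ℂ) ⊗ₖ Y)).trace = (marginalSnd ω * Y).trace := by
  simp only [trace, diag, mul_apply, marginalSnd, kroneckerMap_apply, Fintype.sum_prod_type,
    one_apply, ite_mul, one_mul, zero_mul, mul_ite, mul_zero, Finset.sum_mul]
  rw [Finset.sum_comm]
  refine Finset.sum_congr rfl fun j _ => ?_
  rw [Finset.sum_comm]
  rw [Finset.sum_comm (s := Finset.univ (α := n))]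
  refine Finset.sum_congr rfl fun i _ => ?_
  rw [Finset.sum_comm]
  refine Finset.sum_congr rfl fun j' _ => ?_
  simp

theorem posSemidef_marginalFst {ω : Matrix (m × n) (m × n) ℂ} (h : ω.PosSemidef) :
    (marginalFst ω).PosSemidef := by
  have : marginalFst ω = ∑ j, ω.submatrix (fun i => (i, j)) (fun i => (i, j)) := by
    ext i i'; simp [marginalFst, Matrix.sum_apply]
  rw [this]
  exact posSemidef_sum _ fun j _ => h.submatrix _

theorem posSemidef_marginalSnd {ω : Matrix (m × n) (m × n) ℂ} (h : ω.PosSemidef) :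
    (marginalSnd ω).PosSemidef := by
  have : marginalSnd ω = ∑ i, ω.submatrix (fun j => (i, j)) (fun j => (i, j)) := by
    ext i i'; simp [marginalSnd, Matrix.sum_apply]
  rw [this]
  exact posSemidef_sum _ fun j _ => h.submatrix _

theorem trace_marginalFst (ω : Matrix (m × n) (m × n) ℂ) :
    (marginalFst ω).trace = ω.trace := by
  simp [trace, marginalFst, Fintype.sum_prod_type]

theorem trace_marginalSnd (ω : Matrix (m × n) (m × n) ℂ) :
    (marginalSnd ω).trace = ω.trace := by
  simp only [trace, marginalSnd, Fintype.sum_prod_type, diag]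
  exact Finset.sum_comm

theorem kronecker_conj_rdiag (U : Matrix m m ℂ) (W : Matrix n n ℂ) (a : m → ℝ) (b : n → ℝ) :
    (U * rdiag a * Uᴴ) ⊗ₖ (W * rdiag b * Wᴴ) =
      (U ⊗ₖ W) * rdiag (fun p : m × n => a p.1 * b p.2) * (U ⊗ₖ W)ᴴ := by
  rw [mul_kronecker_mul, mul_kronecker_mul, conjTranspose_kronecker, diagonal_kronecker_diagonal]
  simp only [rdiag, Complex.ofReal_mul]

variable {ω : Matrix (m × n) (m × n) ℂ} {U : Matrix m m ℂ} {W : Matrix n n ℂ}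

/-- The weights of ω in a product basis form a joint distribution whose first marginal consists of
the weights of the reduced operator. -/
theorem sum_conj_kronecker_fst (hW : W * Wᴴ = 1) (f : m → ℝ) :
    ∑ p : m × n, (((U ⊗ₖ W)ᴴ * ω * (U ⊗ₖ W)) p p).re * f p.1 =
      ∑ i, ((Uᴴ * marginalFst ω * U) i i).re * f i := by
  rw [← re_trace_mul_conj_rdiag, ← re_trace_mul_conj_rdiag, ← trace_mul_kronecker_one]
  congr 3
  have h : (1 : Matrix n n ℂ) = W * rdiag (fun _ => 1) * Wᴴ := by simp [rdiag, hW]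
  rw [h, kronecker_conj_rdiag]
  simp

theorem sum_conj_kronecker_snd (hU : U * Uᴴ = 1) (f : n → ℝ) :
    ∑ p : m × n, (((U ⊗ₖ W)ᴴ * ω * (U ⊗ₖ W)) p p).re * f p.2 =
      ∑ i, ((Wᴴ * marginalSnd ω * W) i i).re * f i := by
  rw [← re_trace_mul_conj_rdiag, ← re_trace_mul_conj_rdiag, ← trace_mul_one_kronecker]
  congr 3
  have h : (1 : Matrix m m ℂ) = U * rdiag (fun _ => 1) * Uᴴ := by simp [rdiag, hU]
  rw [h, kronecker_conj_rdiag]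
  simp

theorem suppLE_kronecker_iff (hω : ω.PosSemidef) {A : Matrix m m ℂ} {B : Matrix n n ℂ}
    (hA : A.PosSemidef) (hB : B.PosSemidef) :
    SuppLE ω (A ⊗ₖ B) ↔ SuppLE (marginalFst ω) A ∧ SuppLE (marginalSnd ω) B := by
  obtain ⟨U, a, hU1, hU2, rfl⟩ := exists_unitary_rdiag hA.1
  obtain ⟨W, b, hW1, hW2, rfl⟩ := exists_unitary_rdiag hB.1
  have h1 : (U ⊗ₖ W)ᴴ * (U ⊗ₖ W) = 1 := by
    rw [conjTranspose_kronecker, ← mul_kronecker_mul, hU1, hW1, one_kronecker_one]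
  have h2 : (U ⊗ₖ W) * (U ⊗ₖ W)ᴴ = 1 := by
    rw [conjTranspose_kronecker, ← mul_kronecker_mul, hU2, hW2, one_kronecker_one]
  have hc (p : m × n) := conj_diag_re_nonneg hω (U ⊗ₖ W) p
  rw [kronecker_conj_rdiag, suppLE_conj_rdiag_iff hω _ h1 h2,
    suppLE_conj_rdiag_iff (posSemidef_marginalFst hω) _ hU1 hU2,
    suppLE_conj_rdiag_iff (posSemidef_marginalSnd hω) _ hW1 hW2]
  constructor
  · intro h
    constructor
    · intro i hi
      have := sum_conj_kronecker_fst (ω := ω) (U := U) hW2 (Pi.single i 1)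
      simp only [Pi.single_apply, mul_ite, mul_one, mul_zero, Finset.sum_ite_eq',
        Finset.mem_univ, if_true] at this
      rw [← this]
      refine Finset.sum_eq_zero fun p _ => ?_
      split_ifs with hp
      · exact h p (by rw [hp, hi, zero_mul])
      · rfl
    · intro i hi
      have := sum_conj_kronecker_snd (ω := ω) (W := W) hU2 (Pi.single i 1)
      simp only [Pi.single_apply, mul_ite, mul_one, mul_zero, Finset.sum_ite_eq',
        Finset.mem_univ, if_true] at this
      rw [← this]
      refine Finset.sum_eq_zero fun p _ => ?_
      split_ifs with hp
      · exact h p (by rw [hp, hi, mul_zero])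
      · rfl
  · rintro ⟨hF, hS⟩ p hp
    rcases mul_eq_zero.1 hp with hp | hp
    · have := sum_conj_kronecker_fst (ω := ω) (U := U) hW2 (Pi.single p.1 1)
      simp only [Pi.single_apply, mul_ite, mul_one, mul_zero, Finset.sum_ite_eq',
        Finset.mem_univ, if_true, hF _ hp] at this
      rw [Finset.sum_eq_zero_iff_of_nonneg fun q _ => by split_ifs; exacts [hc q, le_rfl]] at this
      simpa using this p (Finset.mem_univ _)
    · have := sum_conj_kronecker_snd (ω := ω) (W := W) hU2 (Pi.single p.2 1)
      simp only [Pi.single_apply, mul_ite, mul_one, mul_zero, Finset.sum_ite_eq',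
        Finset.mem_univ, if_true, hS _ hp] at this
      rw [Finset.sum_eq_zero_iff_of_nonneg fun q _ => by split_ifs; exacts [hc q, le_rfl]] at this
      simpa using this p (Finset.mem_univ _)

theorem trLog_kronecker (hω : ω.PosSemidef) {A : Matrix m m ℂ} {B : Matrix n n ℂ}
    (hA : A.PosSemidef) (hB : B.PosSemidef) (hs : SuppLE ω (A ⊗ₖ B)) :
    trLog ω (A ⊗ₖ B) = trLog (marginalFst ω) A + trLog (marginalSnd ω) B := by
  obtain ⟨U, a, hU1, hU2, rfl⟩ := exists_unitary_rdiag hA.1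
  obtain ⟨W, b, hW1, hW2, rfl⟩ := exists_unitary_rdiag hB.1
  have h1 : (U ⊗ₖ W)ᴴ * (U ⊗ₖ W) = 1 := by
    rw [conjTranspose_kronecker, ← mul_kronecker_mul, hU1, hW1, one_kronecker_one]
  have h2 : (U ⊗ₖ W) * (U ⊗ₖ W)ᴴ = 1 := by
    rw [conjTranspose_kronecker, ← mul_kronecker_mul, hU2, hW2, one_kronecker_one]
  rw [kronecker_conj_rdiag, suppLE_conj_rdiag_iff hω _ h1 h2] at hs
  rw [kronecker_conj_rdiag, trLog_conj_rdiag _ _ h1 h2, trLog_conj_rdiag _ _ hU1 hU2,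
    trLog_conj_rdiag _ _ hW1 hW2, ← sum_conj_kronecker_fst hW2, ← sum_conj_kronecker_snd hU2,
    ← Finset.sum_add_distrib]
  refine Finset.sum_congr rfl fun p _ => ?_
  -- Since `logb 2 0 = 0`, the logarithm of a product need not split at a zero factor; the support
  -- hypothesis makes the weight vanish there.
  by_cases hp : a p.1 * b p.2 = 0
  · rw [hs p hp]; ring
  · rw [Real.logb_mul (left_ne_zero_of_mul hp) (right_ne_zero_of_mul hp)]; ring

/-- The real value of the mutual information of a positive semidefinite matrix. -/
def mutualInfoReal (ω : Matrix (m × n) (m × n) ℂ) : ℝ :=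
  negEntropy ω - negEntropy (marginalFst ω) - negEntropy (marginalSnd ω)

theorem relEntropy_ne_bot (A B : Matrix n n ℂ) : relEntropy A B ≠ ⊥ := by
  by_cases h : SuppLE A B
  · rw [relEntropy_of_suppLE h]; exact EReal.coe_ne_bot _
  · rw [relEntropy_of_not_suppLE h]; exact top_ne_bot

theorem relEntropy_self (A : Matrix n n ℂ) : relEntropy A A = 0 := by
  rw [relEntropy_of_suppLE (SuppLE.refl A), negEntropy, sub_self, EReal.coe_zero]

/-- The logarithm of a product operator splits into the two marginal terms. The mutual information
is a finite real, so the identity persists in `EReal` when a support condition fails and both sides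
are `⊤`. -/
theorem relEntropy_kronecker (hω : ω.PosSemidef) {A : Matrix m m ℂ} {B : Matrix n n ℂ}
    (hA : A.PosSemidef) (hB : B.PosSemidef) :
    relEntropy ω (A ⊗ₖ B) =
      (mutualInfoReal ω : EReal) + relEntropy (marginalFst ω) A + relEntropy (marginalSnd ω) B := by
  by_cases hs : SuppLE ω (A ⊗ₖ B)
  · obtain ⟨h1, h2⟩ := (suppLE_kronecker_iff hω hA hB).1 hs
    rw [relEntropy_of_suppLE hs, relEntropy_of_suppLE h1, relEntropy_of_suppLE h2,
      trLog_kronecker hω hA hB hs, ← EReal.coe_add, ← EReal.coe_add, mutualInfoReal]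
    congr 1
    ring
  · rw [relEntropy_of_not_suppLE hs]
    rw [suppLE_kronecker_iff hω hA hB, not_and_or] at hs
    rcases hs with h | h
    · rw [relEntropy_of_not_suppLE h, EReal.coe_add_top,
        EReal.top_add_of_ne_bot (relEntropy_ne_bot _ _)]
    · rw [relEntropy_of_not_suppLE h, EReal.add_top_of_ne_bot]
      intro hb
      rcases EReal.add_eq_bot_iff.1 hb with hb | hb
      · exact EReal.coe_ne_bot _ hb
      · exact relEntropy_ne_bot _ _ hb

theorem mutualInformation_eq (hω : ω.PosSemidef) :
    mutualInformation ω = (mutualInfoReal ω : EReal) := by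
  rw [mutualInformation, relEntropy_kronecker hω (posSemidef_marginalFst hω)
    (posSemidef_marginalSnd hω), relEntropy_self, relEntropy_self, add_zero, add_zero]

theorem relEntropy_kronecker_marginalSnd (hω : ω.PosSemidef) {A : Matrix m m ℂ}
    (hA : A.PosSemidef) :
    relEntropy ω (A ⊗ₖ marginalSnd ω) =
      (mutualInfoReal ω : EReal) + relEntropy (marginalFst ω) A := by
  rw [relEntropy_kronecker hω hA (posSemidef_marginalSnd hω), relEntropy_self, add_zero]

end Tensor

/-! ### Entropies of classical-quantum states. -/

section ClassicalQuantum

variable {k : ℕ} {n : Type v} [Fintype n] [DecidableEq n]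

theorem negEntropy_rdiag (d : n → ℝ) : negEntropy (rdiag d) = ∑ j, d j * Real.logb 2 (d j) := by
  simpa using negEntropy_conj_rdiag (1 : Matrix n n ℂ) (by simp) (by simp) d

theorem negEntropy_smul {A : Matrix n n ℂ} (hA : A.IsHermitian) (p : ℝ) :
    negEntropy ((p : ℂ) • A) = p * negEntropy A + A.trace.re * (p * Real.logb 2 p) := by
  obtain ⟨U, a, h1, h2, rfl⟩ := exists_unitary_rdiag hA
  have hs : (p : ℂ) • (U * rdiag a * Uᴴ) = U * rdiag (fun i => p * a i) * Uᴴ := by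
    have : rdiag (fun i => p * a i) = (p : ℂ) • rdiag a := by
      ext i j; by_cases h : i = j
      · subst h; simp
      · simp [h]
    rw [this]; simp
  have ht : (U * rdiag a * Uᴴ).trace.re = ∑ i, a i := by
    rw [trace_mul_comm, ← Matrix.mul_assoc, h1, Matrix.one_mul, trace_diagonal, Complex.re_sum]
    simp
  rw [hs, negEntropy_conj_rdiag U h1 h2, negEntropy_conj_rdiag U h1 h2, ht, Finset.mul_sum,
    Finset.sum_mul, ← Finset.sum_add_distrib]
  refine Finset.sum_congr rfl fun i _ => ?_
  rcases eq_or_ne p 0 with rfl | hp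
  · simp
  rcases eq_or_ne (a i) 0 with ha | ha
  · simp [ha]
  · rw [Real.logb_mul hp ha]; ring

theorem negEntropy_blockDiagonal {M : Fin k → Matrix n n ℂ} (hM : ∀ x, (M x).IsHermitian) :
    negEntropy (blockDiagonal M) = ∑ x, negEntropy (M x) := by
  choose U d h1 h2 h3 using fun x => exists_unitary_rdiag (hM x)
  have hB : blockDiagonal M = blockDiagonal U * rdiag (fun p : n × Fin k => d p.2 p.1) *
      (blockDiagonal U)ᴴ := by
    have : rdiag (fun p : n × Fin k => d p.2 p.1) = blockDiagonal fun x => rdiag (d x) := by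
      rw [blockDiagonal_diagonal]
    rw [this, blockDiagonal_conjTranspose, ← blockDiagonal_mul, ← blockDiagonal_mul]
    congr 1
    funext x
    exact h3 x
  have e1 : (blockDiagonal U)ᴴ * blockDiagonal U = 1 := by
    rw [blockDiagonal_conjTranspose, ← blockDiagonal_mul, ← blockDiagonal_one]
    congr 1
    funext x
    exact h1 x
  have e2 : blockDiagonal U * (blockDiagonal U)ᴴ = 1 := by
    rw [blockDiagonal_conjTranspose, ← blockDiagonal_mul, ← blockDiagonal_one]
    congr 1
    funext x
    exact h2 x
  rw [hB, negEntropy_conj_rdiag _ e1 e2, Fintype.sum_prod_type_right]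
  refine Finset.sum_congr rfl fun x _ => ?_
  conv_rhs => rw [h3 x]
  rw [negEntropy_conj_rdiag _ (h1 x) (h2 x)]

theorem cqState_eq (p : Fin k → ℝ) (ω : Fin k → Matrix n n ℂ) :
    cqState p ω = (blockDiagonal fun x => (p x : ℂ) • ω x).submatrix
      (Equiv.prodComm _ _) (Equiv.prodComm _ _) := by
  ext ⟨x, i⟩ ⟨y, j⟩
  simp only [cqState, Matrix.sum_apply, Matrix.smul_apply, kroneckerMap_apply, single_apply, submatrix_apply,
    Equiv.prodComm_apply, Prod.swap, blockDiagonal_apply, smul_eq_mul]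
  by_cases h : x = y
  · subst h
    rw [Finset.sum_eq_single x]
    · simp
    · intro b _ hb; simp [hb]
    · simp
  · rw [if_neg h]
    refine Finset.sum_eq_zero fun z _ => ?_
    have : ¬ (z = x ∧ z = y) := fun hz => h (hz.1.symm.trans hz.2)
    simp [this]

theorem cqState_apply (p : Fin k → ℝ) (ω : Fin k → Matrix n n ℂ) (s t : Fin k × n) :
    cqState p ω s t = if s.1 = t.1 then (p s.1 : ℂ) * ω s.1 s.2 t.2 else 0 := by
  rw [cqState_eq]
  simp [blockDiagonal_apply]

theorem posSemidef_single_one {m : Type u} [Fintype m] [DecidableEq m] (x : m) :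
    (single x x (1 : ℂ)).PosSemidef := by
  have : single x x (1 : ℂ) = diagonal (Pi.single x 1) := by
    ext i j
    by_cases h : i = j
    · subst h; simp [single_apply, Pi.single_apply, eq_comm]
    · simp only [single_apply, diagonal_apply_ne _ h]
      exact if_neg fun hx => h (hx.1.symm.trans hx.2)
  rw [this]
  refine PosSemidef.diagonal fun i => ?_
  by_cases h : i = x
  · subst h; simp
  · simp [h]

theorem posSemidef_cqState {p : Fin k → ℝ} (hp : ∀ x, 0 ≤ p x) {ω : Fin k → Matrix n n ℂ}
    (hω : ∀ x, (ω x).PosSemidef) : (cqState p ω).PosSemidef := by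
  refine posSemidef_sum _ fun x _ => PosSemidef.smul ?_ (by exact_mod_cast hp x)
  exact (posSemidef_single_one x).kronecker (hω x)

theorem negEntropy_cqState (p : Fin k → ℝ) {ω : Fin k → Matrix n n ℂ}
    (hω : ∀ x, (ω x).PosSemidef) (ht : ∀ x, (ω x).trace = 1) :
    negEntropy (cqState p ω) = ∑ x, p x * negEntropy (ω x) + ∑ x, p x * Real.logb 2 (p x) := by
  have hM (x : Fin k) : ((p x : ℂ) • ω x).IsHermitian := by
    rw [IsHermitian, conjTranspose_smul, (hω x).1.eq]
    simp
  have hB : (blockDiagonal fun x => (p x : ℂ) • ω x).IsHermitian := by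
    rw [IsHermitian, blockDiagonal_conjTranspose]
    congr 1
    funext x
    exact hM x
  rw [cqState_eq, negEntropy_submatrix hB, negEntropy_blockDiagonal hM, ← Finset.sum_add_distrib]
  refine Finset.sum_congr rfl fun x _ => ?_
  rw [negEntropy_smul (hω x).1, ht x]
  simp

theorem marginalFst_cqState (p : Fin k → ℝ) {ω : Fin k → Matrix n n ℂ}
    (ht : ∀ x, (ω x).trace = 1) : marginalFst (cqState p ω) = rdiag p := by
  ext x y
  simp only [marginalFst, cqState_apply]
  by_cases h : x = y
  · subst h
    simp only [if_true, diagonal_apply_eq]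
    rw [← Finset.mul_sum]
    have := ht x
    rw [trace] at this
    simp only [diag] at this
    rw [this, mul_one]
  · simp [h]

theorem marginalSnd_cqState (p : Fin k → ℝ) (ω : Fin k → Matrix n n ℂ) :
    marginalSnd (cqState p ω) = ∑ x, (p x : ℂ) • ω x := by
  ext i j
  simp [marginalSnd, cqState_apply, Matrix.sum_apply]

/-- The Shannon entropy of X occurs in both the joint and the marginal entropy and cancels, leaving
the Holevo quantity. -/
theorem mutualInformation_cqState {p : Fin k → ℝ} (hp : ∀ x, 0 ≤ p x)
    {ω : Fin k → Matrix n n ℂ} (hω : ∀ x, (ω x).PosSemidef) (ht : ∀ x, (ω x).trace = 1) :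
    mutualInformation (cqState p ω) =
      ((∑ x, p x * negEntropy (ω x) - negEntropy (∑ x, (p x : ℂ) • ω x) : ℝ) : EReal) := by
  rw [mutualInformation_eq (posSemidef_cqState hp hω), mutualInfoReal, negEntropy_cqState p hω ht,
    marginalFst_cqState p ht, marginalSnd_cqState, negEntropy_rdiag]
  congr 1
  ring

/-- When all ωˣ share the marginal τ, X is independent of E and the XE marginal is p ⊗ τ. The
Shannon terms again cancel. -/
theorem mutualInformation_regroup_cqState {b : Type w} [Fintype b] [DecidableEq b]
    {p : Fin k → ℝ} (hp : IsDistribution p) {ω : Fin k → Matrix (b × n) (b × n) ℂ}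
    (hω : ∀ x, (ω x).PosSemidef) (ht : ∀ x, (ω x).trace = 1) {τ : Matrix n n ℂ}
    (hτ : ∀ x, marginalSnd (ω x) = τ) (hτp : τ.PosSemidef) (hτt : τ.trace = 1) :
    mutualInformation (reindex (regroup (Fin k) b n) (regroup (Fin k) b n) (cqState p ω)) =
      ((∑ x, p x * (negEntropy (ω x) - negEntropy τ) -
        negEntropy (∑ x, (p x : ℂ) • marginalFst (ω x)) : ℝ) : EReal) := by
  have hpsd := posSemidef_cqState hp.1 hω
  have hF : marginalFst (reindex (regroup (Fin k) b n) (regroup (Fin k) b n) (cqState p ω)) =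
      cqState p fun _ => τ := by
    ext ⟨x, i⟩ ⟨y, j⟩
    simp only [marginalFst, reindex_apply, submatrix_apply, regroup, Equiv.coe_fn_symm_mk,
      cqState_apply]
    by_cases h : x = y
    · subst h
      simp only [if_true]
      rw [← Finset.mul_sum, ← hτ x]
      rfl
    · simp [h]
  have hS : marginalSnd (reindex (regroup (Fin k) b n) (regroup (Fin k) b n) (cqState p ω)) =
      ∑ x, (p x : ℂ) • marginalFst (ω x) := by
    ext i j
    simp [marginalSnd, marginalFst, regroup, cqState_apply, Matrix.sum_apply, Fintype.sum_prod_type,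
      Finset.mul_sum]
  rw [mutualInformation_eq (by rw [reindex_apply]; exact hpsd.submatrix _), mutualInfoReal, hF, hS,
    reindex_apply, negEntropy_submatrix hpsd.1, negEntropy_cqState p hω ht,
    negEntropy_cqState p (fun _ => hτp) (fun _ => hτt)]
  congr 1
  simp only [mul_sub, Finset.sum_sub_distrib]
  ring

end ClassicalQuantum

/-! ### Reduction to a classical double sum, and Klein's inequality. -/

section Joint

variable {n : Type v} [Fintype n] [DecidableEq n] {U W : Matrix n n ℂ} {a s : n → ℝ}

theorem conj_conj_rdiag_apply (d : n → ℝ) (j : n) :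
    ((Wᴴ * (U * rdiag d * Uᴴ) * W) j j).re = ∑ i, ‖(Wᴴ * U) j i‖ ^ 2 * d i := by
  have : Wᴴ * (U * rdiag d * Uᴴ) * W = (Wᴴ * U) * rdiag d * (Wᴴ * U)ᴴ := by
    rw [conjTranspose_mul, conjTranspose_conjTranspose]
    simp only [Matrix.mul_assoc]
  rw [this, conj_rdiag_apply, Complex.ofReal_re]

theorem sum_norm_sq_col {G : Matrix n n ℂ} (h : Gᴴ * G = 1) (i : n) : ∑ j, ‖G j i‖ ^ 2 = 1 := by
  have := congrFun (congrFun h i) i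
  rw [mul_apply, one_apply_eq] at this
  simp only [conjTranspose_apply] at this
  have h2 : ((∑ j, ‖G j i‖ ^ 2 : ℝ) : ℂ) = 1 := by
    rw [← this]
    push_cast
    exact Finset.sum_congr rfl fun j _ => (Complex.conj_mul' _).symm
  exact_mod_cast h2

theorem sum_norm_sq_row {G : Matrix n n ℂ} (h : G * Gᴴ = 1) (j : n) : ∑ i, ‖G j i‖ ^ 2 = 1 := by
  have h' : (Gᴴ)ᴴ * Gᴴ = 1 := by rw [conjTranspose_conjTranspose, h]
  simpa using sum_norm_sq_col h' j

theorem trace_conj_rdiag (h1 : Uᴴ * U = 1) : (U * rdiag a * Uᴴ).trace.re = ∑ i, a i := by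
  rw [trace_mul_comm, ← Matrix.mul_assoc, h1, Matrix.one_mul, trace_diagonal, Complex.re_sum]
  simp

theorem sum_sum_norm_sq_mul {G : Matrix n n ℂ} (h : Gᴴ * G = 1) (f : n → ℝ) :
    ∑ j, ∑ i, ‖G j i‖ ^ 2 * f i = ∑ i, f i := by
  rw [Finset.sum_comm]
  refine Finset.sum_congr rfl fun i _ => ?_
  rw [← Finset.sum_mul, sum_norm_sq_col h, one_mul]

theorem conjTranspose_mul_unitary (hU1 : Uᴴ * U = 1) (hW2 : W * Wᴴ = 1) :
    (Wᴴ * U)ᴴ * (Wᴴ * U) = 1 := by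
  rw [conjTranspose_mul, conjTranspose_conjTranspose]
  calc Uᴴ * W * (Wᴴ * U) = Uᴴ * (W * Wᴴ) * U := by simp only [Matrix.mul_assoc]
    _ = 1 := by rw [hW2, Matrix.mul_one, hU1]

/-- With two eigenbases at hand, the squared overlaps turn relative entropy into a classical sum
over pairs of eigenvalues. The factor `log 2` changes bits to natural units. -/
theorem negEntropy_sub_trLog_eq (hU1 : Uᴴ * U = 1) (hU2 : U * Uᴴ = 1) (hW1 : Wᴴ * W = 1)
    (hW2 : W * Wᴴ = 1) :
    (negEntropy (U * rdiag a * Uᴴ) - trLog (U * rdiag a * Uᴴ) (W * rdiag s * Wᴴ)) * Real.log 2 =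
      ∑ j, ∑ i, ‖(Wᴴ * U) j i‖ ^ 2 * a i * (Real.log (a i) - Real.log (s j)) := by
  rw [negEntropy_conj_rdiag U hU1 hU2, trLog_conj_rdiag _ W hW1 hW2,
    ← sum_sum_norm_sq_mul (conjTranspose_mul_unitary hU1 hW2), ← Finset.sum_sub_distrib,
    Finset.sum_mul]
  refine Finset.sum_congr rfl fun j _ => ?_
  rw [conj_conj_rdiag_apply, Finset.sum_mul, ← Finset.sum_sub_distrib, Finset.sum_mul]
  refine Finset.sum_congr rfl fun i _ => ?_
  have : Real.log 2 ≠ 0 := by positivity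
  simp only [Real.logb]
  field_simp

theorem suppLE_joint (ha : ∀ i, 0 ≤ a i) (hW1 : Wᴴ * W = 1) (hW2 : W * Wᴴ = 1)
    (hs : SuppLE (U * rdiag a * Uᴴ) (W * rdiag s * Wᴴ)) (j i : n) (hj : s j = 0) :
    ‖(Wᴴ * U) j i‖ ^ 2 * a i = 0 := by
  have hpsd : (U * rdiag a * Uᴴ).PosSemidef :=
    (PosSemidef.diagonal fun i => by simpa using ha i).mul_mul_conjTranspose_same U
  have := (suppLE_conj_rdiag_iff hpsd W hW1 hW2 s).1 hs j hj
  rw [conj_conj_rdiag_apply, Finset.sum_eq_zero_iff_of_nonneg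
    fun i _ => mul_nonneg (sq_nonneg _) (ha i)] at this
  exact this i (Finset.mem_univ _)

/-- Klein's inequality. -/
theorem trLog_le_negEntropy {ρ σ : Matrix n n ℂ} (hρ : ρ.PosSemidef) (hσ : σ.PosSemidef)
    (ht : ρ.trace = σ.trace) (hs : SuppLE ρ σ) : trLog ρ σ ≤ negEntropy ρ := by
  obtain ⟨U, a, hU1, hU2, rfl, ha⟩ := exists_unitary_rdiag_nonneg hρ
  obtain ⟨W, s, hW1, hW2, rfl, hs0⟩ := exists_unitary_rdiag_nonneg hσ
  have hG := conjTranspose_mul_unitary hU1 hW2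
  have hG' : (Wᴴ * U) * (Wᴴ * U)ᴴ = 1 := by
    simpa [conjTranspose_mul] using conjTranspose_mul_unitary hW1 hU2
  have htr : ∑ i, a i = ∑ j, s j := by
    rw [← trace_conj_rdiag hU1, ← trace_conj_rdiag hW1, ht]
  have h0 : (0 : ℝ) ≤ ∑ j, ∑ i, ‖(Wᴴ * U) j i‖ ^ 2 * a i * (Real.log (a i) - Real.log (s j)) := by
    -- The squared overlaps are doubly stochastic, so equality of traces makes this sum vanish. It
    -- suffices to compare termwise using a log(a/s) ≥ a - s.
    have e1 : ∑ j, ∑ i, ‖(Wᴴ * U) j i‖ ^ 2 * (a i - s j) = 0 := by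
      simp only [mul_sub, Finset.sum_sub_distrib]
      rw [sum_sum_norm_sq_mul hG, htr]
      simp only [← Finset.sum_mul, sum_norm_sq_row hG', one_mul, sub_self]
    rw [← e1]
    refine Finset.sum_le_sum fun j _ => Finset.sum_le_sum fun i _ => ?_
    have hc : 0 ≤ ‖(Wᴴ * U) j i‖ ^ 2 := sq_nonneg _
    rcases (hs0 j).eq_or_lt with hj | hj
    · have := suppLE_joint ha hW1 hW2 hs j i hj.symm
      rw [this, ← hj, sub_zero, this, zero_mul]
    · rcases (ha i).eq_or_lt with hi | hi
      · rw [← hi]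
        simp only [mul_zero, zero_mul, zero_sub]
        nlinarith
      · rw [mul_assoc]
        refine mul_le_mul_of_nonneg_left ?_ hc
        rw [← Real.log_div hi.ne' hj.ne']
        have h1 := Real.one_sub_inv_le_log_of_pos (div_pos hi hj)
        have h2 := mul_le_mul_of_nonneg_left h1 hi.le
        have h3 : a i * (1 - (a i / s j)⁻¹) = a i - s j := by field_simp
        linarith
  rw [← negEntropy_sub_trLog_eq hU1 hU2 hW1 hW2] at h0
  have : 0 < Real.log 2 := Real.log_pos (by norm_num)
  have := nonneg_of_mul_nonneg_left h0 this
  linarith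

end Joint

/-! ### Monotonicity of relative entropy under Kraus maps. -/

section DataProcessing

variable {m : Type u} {n : Type v} [Fintype m] [DecidableEq m] [Fintype n] [DecidableEq n]

/-- The concave functional of `w` whose maximum is an integrand in an integral representation of
the relative entropy. -/
def entropyForm (ρ σ : Matrix n n ℂ) (t : ℝ) (w : Matrix n n ℂ) : ℝ :=
  2 * (wᴴ * ρ).trace.re - (wᴴ * σ * w).trace.re - t * (w * ρ * wᴴ).trace.re

/-- In the coordinates y = Wᴴ w U the form decouples into one scalar quadratic per matrix entry, to
be maximised by completing the square. -/
theorem entropyForm_eq {U W : Matrix n n ℂ} (hU1 : Uᴴ * U = 1) (hW1 : Wᴴ * W = 1) (a s : n → ℝ)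
    (t : ℝ) (y : Matrix n n ℂ) :
    entropyForm (U * rdiag a * Uᴴ) (W * rdiag s * Wᴴ) t (W * y * Uᴴ) =
      ∑ j, ∑ i, (2 * (star (y j i) * (Wᴴ * U) j i).re * a i - ‖y j i‖ ^ 2 * (s j + t * a i)) := by
  have hw : (W * y * Uᴴ)ᴴ = U * yᴴ * Wᴴ := by
    simp only [conjTranspose_mul, conjTranspose_conjTranspose, Matrix.mul_assoc]
  have e1 : ((W * y * Uᴴ)ᴴ * (U * rdiag a * Uᴴ)).trace = (yᴴ * (Wᴴ * U) * rdiag a).trace := by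
    rw [hw]
    calc (U * yᴴ * Wᴴ * (U * rdiag a * Uᴴ)).trace
        = (U * (yᴴ * (Wᴴ * U) * rdiag a * Uᴴ)).trace := by simp only [Matrix.mul_assoc]
      _ = (yᴴ * (Wᴴ * U) * rdiag a * (Uᴴ * U)).trace := by
        rw [trace_mul_comm]; simp only [Matrix.mul_assoc]
      _ = _ := by rw [hU1, Matrix.mul_one]
  have e2 : ((W * y * Uᴴ)ᴴ * (W * rdiag s * Wᴴ) * (W * y * Uᴴ)).trace =
      (yᴴ * rdiag s * y).trace := by
    rw [hw]
    calc (U * yᴴ * Wᴴ * (W * rdiag s * Wᴴ) * (W * y * Uᴴ)).trace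
        = (U * (yᴴ * (Wᴴ * W) * rdiag s * (Wᴴ * W) * y * Uᴴ)).trace := by
          simp only [Matrix.mul_assoc]
      _ = (yᴴ * rdiag s * y * (Uᴴ * U)).trace := by
        rw [trace_mul_comm, hW1]; simp only [Matrix.mul_assoc, Matrix.mul_one]
      _ = _ := by rw [hU1, Matrix.mul_one]
  have e3 : ((W * y * Uᴴ) * (U * rdiag a * Uᴴ) * (W * y * Uᴴ)ᴴ).trace =
      (y * rdiag a * yᴴ).trace := by
    rw [hw]
    calc ((W * y * Uᴴ) * (U * rdiag a * Uᴴ) * (U * yᴴ * Wᴴ)).trace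
        = (W * (y * (Uᴴ * U) * rdiag a * (Uᴴ * U) * yᴴ * Wᴴ)).trace := by
          simp only [Matrix.mul_assoc]
      _ = (y * rdiag a * yᴴ * (Wᴴ * W)).trace := by
        rw [trace_mul_comm, hU1]; simp only [Matrix.mul_assoc, Matrix.mul_one]
      _ = _ := by rw [hW1, Matrix.mul_one]
  have f1 : (yᴴ * (Wᴴ * U) * rdiag a).trace.re =
      ∑ j, ∑ i, (star (y j i) * (Wᴴ * U) j i).re * a i := by
    rw [Finset.sum_comm, trace, Complex.re_sum]
    refine Finset.sum_congr rfl fun i _ => ?_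
    rw [diag, mul_diagonal, Complex.re_mul_ofReal, mul_apply, Complex.re_sum, Finset.sum_mul]
    simp only [conjTranspose_apply]
  have f2 : (yᴴ * rdiag s * y).trace.re = ∑ j, ∑ i, ‖y j i‖ ^ 2 * s j := by
    have : (yᴴ * rdiag s * y) = yᴴ * rdiag s * (yᴴ)ᴴ := by rw [conjTranspose_conjTranspose]
    rw [this, Finset.sum_comm, trace, Complex.re_sum]
    refine Finset.sum_congr rfl fun i _ => ?_
    rw [diag, conj_rdiag_apply, Complex.ofReal_re]
    simp only [conjTranspose_apply, norm_star]
  have f3 : (y * rdiag a * yᴴ).trace.re = ∑ j, ∑ i, ‖y j i‖ ^ 2 * a i := by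
    rw [trace, Complex.re_sum]
    refine Finset.sum_congr rfl fun i _ => ?_
    rw [diag, conj_rdiag_apply, Complex.ofReal_re]
  rw [entropyForm, e1, e2, e3, f1, f2, f3, Finset.mul_sum, Finset.mul_sum, ← Finset.sum_sub_distrib,
    ← Finset.sum_sub_distrib]
  refine Finset.sum_congr rfl fun j _ => ?_
  rw [Finset.mul_sum, Finset.mul_sum, ← Finset.sum_sub_distrib, ← Finset.sum_sub_distrib]
  refine Finset.sum_congr rfl fun i _ => ?_
  ring

theorem two_mul_re_sub_le {y g : ℂ} {a s t : ℝ} (ha : 0 ≤ a) (hs : 0 ≤ s) (ht : 0 < t) :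
    2 * (star y * g).re * a - ‖y‖ ^ 2 * (s + t * a) ≤ ‖g‖ ^ 2 * a * (a / (s + t * a)) := by
  have hre : (star y * g).re ≤ ‖y‖ * ‖g‖ := by
    refine (Complex.re_le_norm _).trans ?_
    rw [norm_mul, norm_star]
  rcases ha.eq_or_lt with rfl | ha
  · simp only [mul_zero, add_zero, zero_div, zero_sub]
    nlinarith [sq_nonneg ‖y‖]
  · have hp : 0 < s + t * a := by positivity
    have : ‖g‖ ^ 2 * a * (a / (s + t * a)) = (‖g‖ * a) ^ 2 / (s + t * a) := by ring
    rw [this, le_div_iff₀ hp]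
    have h1 : (star y * g).re * (a * (s + t * a)) ≤ ‖y‖ * ‖g‖ * (a * (s + t * a)) :=
      mul_le_mul_of_nonneg_right hre (by positivity)
    nlinarith [sq_nonneg (‖y‖ * (s + t * a) - ‖g‖ * a)]

theorem two_mul_re_sub_eq {g : ℂ} {a s t : ℝ} (ha : 0 ≤ a) (hs : 0 ≤ s) (ht : 0 < t) :
    2 * (star (g * ((a / (s + t * a) : ℝ) : ℂ)) * g).re * a
      - ‖g * ((a / (s + t * a) : ℝ) : ℂ)‖ ^ 2 * (s + t * a) = ‖g‖ ^ 2 * a * (a / (s + t * a)) := by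
  have h1 : star (g * ((a / (s + t * a) : ℝ) : ℂ)) * g =
      ((‖g‖ ^ 2 * (a / (s + t * a)) : ℝ) : ℂ) := by
    rw [star_mul', mul_right_comm, Complex.star_def, Complex.conj_mul', Complex.conj_ofReal]
    push_cast
    rfl
  rw [h1, Complex.ofReal_re, norm_mul, mul_pow, Complex.norm_real, Real.norm_eq_abs, sq_abs]
  rcases ha.eq_or_lt with rfl | ha
  · simp
  · have hp : s + t * a ≠ 0 := by positivity
    field_simp
    ring

theorem tendsto_log_ratio {a s : ℝ} (ha : 0 < a) (hs : 0 < s) :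
    Tendsto (fun T : ℝ => Real.log (s + T * a) - Real.log (1 + T)) atTop (𝓝 (Real.log a)) := by
  have h1 : Tendsto (fun T : ℝ => 1 + T) atTop atTop := tendsto_atTop_add_const_left _ _ tendsto_id
  have h2 : Tendsto (fun T : ℝ => a + (s - a) * (1 + T)⁻¹) atTop (𝓝 a) := by
    have := (tendsto_inv_atTop_zero.comp h1).const_mul (s - a)
    simpa using this.const_add a
  have h3 := (Real.continuousAt_log ha.ne').tendsto.comp h2
  refine h3.congr' ?_
  filter_upwards [eventually_ge_atTop 0] with T hT
  have hp : 0 < 1 + T := by linarith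
  have hq : 0 < s + T * a := by positivity
  rw [Function.comp_apply, ← Real.log_div hq.ne' hp.ne']
  congr 1
  field_simp
  ring

/-- Here q(t) is the maximum of `entropyForm` over w and R is its explicit antiderivative, so no
integral is needed. The sum defining R diverges like Tr ρ · log(1 + T), and removing this term
leaves the relative entropy, because log((s + Ta)/(1 + T)) → log a. -/
theorem exists_entropy_integral {ρ σ : Matrix n n ℂ} (hρ : ρ.PosSemidef) (hσ : σ.PosSemidef)
    (hs : SuppLE ρ σ) : ∃ R q : ℝ → ℝ,
      (∀ t, 0 ≤ t → HasDerivAt R (q t) t) ∧ R 0 = 0 ∧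
      Tendsto (fun T => R T - ρ.trace.re * Real.log (1 + T)) atTop
        (𝓝 ((negEntropy ρ - trLog ρ σ) * Real.log 2)) ∧
      (∀ t, 0 < t → ∀ w, entropyForm ρ σ t w ≤ q t) ∧
      (∀ t, 0 < t → ∃ w, entropyForm ρ σ t w = q t) := by
  obtain ⟨U, a, hU1, hU2, rfl, ha⟩ := exists_unitary_rdiag_nonneg hρ
  obtain ⟨W, s, hW1, hW2, rfl, hs0⟩ := exists_unitary_rdiag_nonneg hσ
  -- Each pair of eigenvalues either has zero weight or is strictly positive, so no logarithm is
  -- differentiated at zero.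
  have hz (j i : n) : ‖(Wᴴ * U) j i‖ ^ 2 * a i = 0 ∨ (0 < a i ∧ 0 < s j) := by
    rcases (hs0 j).eq_or_lt with hj | hj
    · exact Or.inl (suppLE_joint ha hW1 hW2 hs j i hj.symm)
    · rcases (ha i).eq_or_lt with hi | hi
      · left; rw [← hi, mul_zero]
      · exact Or.inr ⟨hi, hj⟩
  have hG := conjTranspose_mul_unitary hU1 hW2
  have hW (w : Matrix n n ℂ) : w = W * (Wᴴ * w * U) * Uᴴ := by
    calc w = (W * Wᴴ) * w * (U * Uᴴ) := by rw [hW2, hU2, Matrix.one_mul, Matrix.mul_one]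
      _ = _ := by simp only [Matrix.mul_assoc]
  refine ⟨fun T => ∑ j, ∑ i, ‖(Wᴴ * U) j i‖ ^ 2 * a i *
      (Real.log (s j + T * a i) - Real.log (s j)),
    fun t => ∑ j, ∑ i, ‖(Wᴴ * U) j i‖ ^ 2 * a i * (a i / (s j + t * a i)), ?_, ?_, ?_, ?_, ?_⟩
  · intro t ht
    refine HasDerivAt.fun_sum fun j _ => HasDerivAt.fun_sum fun i _ => ?_
    rcases hz j i with h | ⟨hi, hj⟩
    · simp only [h, zero_mul]; exact hasDerivAt_const _ _
    · have hp : s j + t * a i ≠ 0 := by positivity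
      have h1 : HasDerivAt (fun T => s j + T * a i) (a i) t := by
        simpa using ((hasDerivAt_id t).mul_const (a i)).const_add (s j)
      exact ((h1.log hp).sub_const _).const_mul _
  · simp
  · rw [negEntropy_sub_trLog_eq hU1 hU2 hW1 hW2]
    have e (T : ℝ) : ∑ j, ∑ i, ‖(Wᴴ * U) j i‖ ^ 2 * a i *
        (Real.log (s j + T * a i) - Real.log (s j)) - (U * rdiag a * Uᴴ).trace.re *
          Real.log (1 + T) = ∑ j, ∑ i, ‖(Wᴴ * U) j i‖ ^ 2 * a i *
        (Real.log (s j + T * a i) - Real.log (1 + T) - Real.log (s j)) := by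
      rw [trace_conj_rdiag hU1, ← sum_sum_norm_sq_mul hG a, Finset.sum_mul,
        ← Finset.sum_sub_distrib]
      refine Finset.sum_congr rfl fun j _ => ?_
      rw [Finset.sum_mul, ← Finset.sum_sub_distrib]
      exact Finset.sum_congr rfl fun i _ => by ring
    simp only [e]
    refine tendsto_finsetSum _ fun j _ => tendsto_finsetSum _ fun i _ => ?_
    rcases hz j i with h | ⟨hi, hj⟩
    · simp only [h, zero_mul]; exact tendsto_const_nhds
    · exact ((tendsto_log_ratio hi hj).sub_const _).const_mul _
  · intro t ht w
    rw [hW w, entropyForm_eq hU1 hW1]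
    exact Finset.sum_le_sum fun j _ => Finset.sum_le_sum fun i _ =>
      two_mul_re_sub_le (ha i) (hs0 j) ht
  · intro t ht
    -- The witness is the vertex of each scalar quadratic, y = g a/(s + ta).
    refine ⟨W * (Matrix.of fun j i => (Wᴴ * U) j i * ((a i / (s j + t * a i) : ℝ) : ℂ)) * Uᴴ, ?_⟩
    rw [entropyForm_eq hU1 hW1]
    exact Finset.sum_congr rfl fun j _ => Finset.sum_congr rfl fun i _ =>
      two_mul_re_sub_eq (ha i) (hs0 j) ht

variable {ι : Type w} [Fintype ι] {V : ι → Matrix n m ℂ}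

/-- The completely positive map with Kraus operators `V`. -/
def krausMap (V : ι → Matrix n m ℂ) (A : Matrix m m ℂ) : Matrix n n ℂ := ∑ k, V k * A * (V k)ᴴ

/-- The adjoint of the completely positive map with Kraus operators `V`. -/
def krausAdj (V : ι → Matrix n m ℂ) (w : Matrix n n ℂ) : Matrix m m ℂ := ∑ k, (V k)ᴴ * w * V k

theorem posSemidef_krausMap {A : Matrix m m ℂ} (hA : A.PosSemidef) :
    (krausMap V A).PosSemidef :=
  posSemidef_sum _ fun k _ => hA.mul_mul_conjTranspose_same (V k)

theorem trace_mul_krausMap (w : Matrix n n ℂ) (A : Matrix m m ℂ) :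
    (w * krausMap V A).trace = (krausAdj V w * A).trace := by
  rw [krausMap, krausAdj, Matrix.mul_sum, Matrix.sum_mul, trace_sum, trace_sum]
  refine Finset.sum_congr rfl fun k _ => ?_
  rw [← Matrix.mul_assoc, trace_mul_comm]
  simp only [Matrix.mul_assoc]

theorem krausAdj_conjTranspose (w : Matrix n n ℂ) : krausAdj V wᴴ = (krausAdj V w)ᴴ := by
  rw [krausAdj, krausAdj, conjTranspose_sum]
  simp only [conjTranspose_mul, conjTranspose_conjTranspose, Matrix.mul_assoc]

theorem trace_krausMap (hV : ∑ k, (V k)ᴴ * V k = 1) (A : Matrix m m ℂ) :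
    (krausMap V A).trace = A.trace := by
  have := trace_mul_krausMap (V := V) 1 A
  simpa [krausAdj, hV] using this

/-- With X = Φ*(w), expand the nonnegative sum of Tr[Yₖᴴ A Yₖ] for Yₖ = Vₖᴴ w - X Vₖᴴ. By unitality
of Φ* it equals Tr[wᴴ Φ(A) w] - Tr[Xᴴ A X]. -/
theorem schwarz_krausAdj (hV : ∑ k, (V k)ᴴ * V k = 1) {A : Matrix m m ℂ} (hA : A.PosSemidef)
    (w : Matrix n n ℂ) :
    ((krausAdj V w)ᴴ * A * krausAdj V w).trace.re ≤ (wᴴ * krausMap V A * w).trace.re := by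
  set X := krausAdj V w with hX
  have hXs : X = ∑ k, (V k)ᴴ * w * V k := rfl
  have hXc : Xᴴ = ∑ k, (V k)ᴴ * wᴴ * V k := by rw [hX, ← krausAdj_conjTranspose]; rfl
  have h0 : 0 ≤ ∑ k, (((V k)ᴴ * w - X * (V k)ᴴ)ᴴ * A * ((V k)ᴴ * w - X * (V k)ᴴ)).trace.re :=
    Finset.sum_nonneg fun k _ =>
      (Complex.le_def.1 (hA.conjTranspose_mul_mul_same ((V k)ᴴ * w - X * (V k)ᴴ)).trace_nonneg).1
  have e (k : ι) : (((V k)ᴴ * w - X * (V k)ᴴ)ᴴ * A * ((V k)ᴴ * w - X * (V k)ᴴ)).trace =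
      (wᴴ * (V k * A * (V k)ᴴ) * w).trace - ((V k)ᴴ * wᴴ * V k * (A * X)).trace
        - (Xᴴ * A * ((V k)ᴴ * w * V k)).trace + (Xᴴ * A * X * ((V k)ᴴ * V k)).trace := by
    rw [conjTranspose_sub, conjTranspose_mul, conjTranspose_mul, conjTranspose_conjTranspose,
      Matrix.sub_mul, Matrix.sub_mul, Matrix.mul_sub, Matrix.mul_sub, trace_sub, trace_sub,
      trace_sub]
    have e1 : (wᴴ * V k * A * (X * (V k)ᴴ)).trace = ((V k)ᴴ * wᴴ * V k * (A * X)).trace := by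
      rw [← Matrix.mul_assoc, trace_mul_comm]; simp only [Matrix.mul_assoc]
    have e2 : (V k * Xᴴ * A * ((V k)ᴴ * w)).trace = (Xᴴ * A * ((V k)ᴴ * w * V k)).trace := by
      simp only [Matrix.mul_assoc]; rw [trace_mul_comm]; simp only [Matrix.mul_assoc]
    have e3 : (V k * Xᴴ * A * (X * (V k)ᴴ)).trace = (Xᴴ * A * X * ((V k)ᴴ * V k)).trace := by
      simp only [Matrix.mul_assoc]; rw [trace_mul_comm]; simp only [Matrix.mul_assoc]
    rw [e1, e2, e3]
    simp only [Matrix.mul_assoc]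
    ring
  have hsum : ∑ k, (((V k)ᴴ * w - X * (V k)ᴴ)ᴴ * A * ((V k)ᴴ * w - X * (V k)ᴴ)).trace =
      (wᴴ * krausMap V A * w).trace - (Xᴴ * A * X).trace := by
    rw [Finset.sum_congr rfl fun k _ => e k, Finset.sum_add_distrib, Finset.sum_sub_distrib,
      Finset.sum_sub_distrib, ← trace_sum, ← trace_sum, ← trace_sum, ← trace_sum, ← Matrix.sum_mul,
      ← Matrix.sum_mul, ← Matrix.mul_sum, ← Matrix.mul_sum, ← Matrix.mul_sum, hV, ← hXs, ← hXc,
      Matrix.mul_one, Matrix.mul_assoc Xᴴ A X, krausMap]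
    ring
  rw [← Complex.re_sum, hsum, Complex.sub_re] at h0
  linarith

/-- The linear term is preserved by duality. Each of the two subtracted quadratic terms obeys the
Schwarz inequality, with w for σ and wᴴ for ρ. -/
theorem entropyForm_krausMap_le (hV : ∑ k, (V k)ᴴ * V k = 1) {ρ σ : Matrix m m ℂ}
    (hρ : ρ.PosSemidef) (hσ : σ.PosSemidef) {t : ℝ} (ht : 0 ≤ t) (w : Matrix n n ℂ) :
    entropyForm (krausMap V ρ) (krausMap V σ) t w ≤ entropyForm ρ σ t (krausAdj V w) := by
  have h1 := schwarz_krausAdj hV hσ w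
  have h2 := schwarz_krausAdj hV hρ wᴴ
  rw [krausAdj_conjTranspose, conjTranspose_conjTranspose, conjTranspose_conjTranspose] at h2
  rw [entropyForm, entropyForm, trace_mul_krausMap, krausAdj_conjTranspose]
  nlinarith

/-- Monotonicity of the relative entropy under quantum channels in Kraus form. -/
theorem relEntropy_krausMap_le (hV : ∑ k, (V k)ᴴ * V k = 1) {ρ σ : Matrix m m ℂ}
    (hρ : ρ.PosSemidef) (hσ : σ.PosSemidef) (hs : SuppLE ρ σ)
    (hs' : SuppLE (krausMap V ρ) (krausMap V σ)) :
    negEntropy (krausMap V ρ) - trLog (krausMap V ρ) (krausMap V σ) ≤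
      negEntropy ρ - trLog ρ σ := by
  obtain ⟨R, q, hR, hR0, hlim, hle, -⟩ := exists_entropy_integral hρ hσ hs
  obtain ⟨R', q', hR', hR0', hlim', -, heq'⟩ :=
    exists_entropy_integral (posSemidef_krausMap hρ) (posSemidef_krausMap hσ) hs'
  have hq (t : ℝ) (ht : 0 < t) : q' t ≤ q t := by
    obtain ⟨w, hw⟩ := heq' t ht
    rw [← hw]
    exact (entropyForm_krausMap_le hV hρ hσ ht.le w).trans (hle t ht _)
  -- Comparing the maxima of the two forms gives q' ≤ q, hence R' ≤ R. The subtracted logarithmic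
  -- terms agree since the trace is preserved.
  have hmono : MonotoneOn (fun t => R t - R' t) (Set.Ici 0) := by
    refine monotoneOn_of_hasDerivWithinAt_nonneg (convex_Ici 0) (f' := fun t => q t - q' t)
      (fun t ht => ((hR t ht).sub (hR' t ht)).continuousAt.continuousWithinAt) ?_ ?_
    · intro t ht
      rw [interior_Ici] at ht
      exact ((hR t (le_of_lt ht)).sub (hR' t (le_of_lt ht))).hasDerivWithinAt
    · intro t ht
      rw [interior_Ici] at ht
      exact sub_nonneg.2 (hq t ht)
  have hRR (T : ℝ) (hT : 0 ≤ T) : R' T ≤ R T := by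
    have := hmono (Set.self_mem_Ici) hT hT
    simp only [hR0, hR0', sub_self] at this
    linarith
  have hfin := le_of_tendsto_of_tendsto hlim' hlim (by
    filter_upwards [eventually_ge_atTop 0] with T hT
    rw [trace_krausMap hV]
    exact sub_le_sub_right (hRR T hT) _)
  exact le_of_mul_le_mul_right hfin (Real.log_pos (by norm_num))

end DataProcessing

/-! ### Continuity of entropy and semicontinuity of relative entropy. -/

section Continuity

variable {n : Type v} [Fintype n] [DecidableEq n]

section L2

open scoped Matrix.Norms.L2Operator

/-- Continuity of the functional calculus is a C*-algebra fact, hence the operator norm. Its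
topology is the entrywise one, so the next statement carries no norm. -/
theorem continuousOn_cfc_l2 (f : ℝ → ℝ) (hf : Continuous f) :
    ContinuousOn (fun A : Matrix n n ℂ => cfc f A) {A | IsSelfAdjoint A} :=
  ContinuousOn.cfc_of_mem_nhdsSet f (s := Set.univ) Filter.univ_mem continuousOn_id
    (fun _ h => h) hf.continuousOn

end L2

theorem continuousOn_cfc_isHermitian (f : ℝ → ℝ) (hf : Continuous f) :
    ContinuousOn (fun A : Matrix n n ℂ => cfc f A) {A | A.IsHermitian} :=
  continuousOn_cfc_l2 f hf

/-- Unlike the logarithm, x log x is continuous at 0; entropy becomes the trace of a single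
continuous functional calculus. -/
theorem negEntropy_eq_trace_cfc {A : Matrix n n ℂ} (hA : A.IsHermitian) :
    negEntropy A = (cfc (fun x => x * Real.logb 2 x) A).trace.re := by
  obtain ⟨U, a, h1, h2, rfl⟩ := exists_unitary_rdiag hA
  rw [negEntropy_conj_rdiag U h1 h2, cfc_conj_rdiag U h1 h2, trace_conj_rdiag h1]

theorem continuousOn_negEntropy :
    ContinuousOn (negEntropy : Matrix n n ℂ → ℝ) {A | A.IsHermitian} := by
  have hf : Continuous fun x : ℝ => x * Real.logb 2 x := by
    have : (fun x : ℝ => x * Real.logb 2 x) = fun x => x * Real.log x / Real.log 2 := by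
      funext x; rw [Real.logb, mul_div_assoc]
    rw [this]
    exact Real.continuous_mul_log.div_const _
  have h1 := continuousOn_cfc_isHermitian (n := n) _ hf
  refine ContinuousOn.congr ?_ fun A hA => negEntropy_eq_trace_cfc hA
  exact Complex.continuous_re.comp_continuousOn
    ((continuous_id.matrix_trace).comp_continuousOn h1)

/-- `Re Tr(ω log₂(σ + δ))` for positive semidefinite `σ`. -/
def regTrLog (δ : ℝ) (ω σ : Matrix n n ℂ) : ℝ :=
  (ω * cfc (fun x => Real.logb 2 (max x 0 + δ)) σ).trace.re

theorem regTrLog_conj_rdiag (δ : ℝ) (ω U : Matrix n n ℂ) (h1 : Uᴴ * U = 1) (h2 : U * Uᴴ = 1)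
    {d : n → ℝ} (hd : ∀ i, 0 ≤ d i) :
    regTrLog δ ω (U * rdiag d * Uᴴ) =
      ∑ j, ((Uᴴ * ω * U) j j).re * Real.logb 2 (d j + δ) := by
  rw [regTrLog, cfc_conj_rdiag U h1 h2, re_trace_mul_conj_rdiag]
  simp only [max_eq_left (hd _)]

theorem continuousOn_regTrLog {δ : ℝ} (hδ : 0 < δ) (ω : Matrix n n ℂ) :
    ContinuousOn (regTrLog δ ω) {A | A.IsHermitian} := by
  have hf : Continuous fun x : ℝ => Real.logb 2 (max x 0 + δ) := by
    simp only [Real.logb]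
    refine Continuous.div_const (Continuous.log (by fun_prop) fun x => ?_) _
    have : 0 ≤ max x 0 := le_max_right _ _
    positivity
  have h1 := continuousOn_cfc_isHermitian (n := n) _ hf
  exact Complex.continuous_re.comp_continuousOn
    ((continuous_const.matrix_mul continuous_id).matrix_trace.comp_continuousOn h1)

theorem trLog_le_regTrLog {δ : ℝ} (hδ : 0 < δ) {ω σ : Matrix n n ℂ} (hω : ω.PosSemidef)
    (hσ : σ.PosSemidef) (hs : SuppLE ω σ) : trLog ω σ ≤ regTrLog δ ω σ := by
  obtain ⟨U, d, h1, h2, rfl, hd⟩ := exists_unitary_rdiag_nonneg hσ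
  rw [suppLE_conj_rdiag_iff hω U h1 h2] at hs
  rw [trLog_conj_rdiag _ U h1 h2, regTrLog_conj_rdiag δ _ U h1 h2 hd]
  refine Finset.sum_le_sum fun j _ => ?_
  rcases (hd j).eq_or_lt with hj | hj
  · rw [hs j hj.symm, zero_mul, zero_mul]
  · refine mul_le_mul_of_nonneg_left ?_ (conj_diag_re_nonneg hω U j)
    exact Real.logb_le_logb_of_le (by norm_num) hj (by linarith)

theorem tendsto_logb_nhdsGT_zero : Tendsto (Real.logb 2) (𝓝[>] 0) atBot := by
  have h : 0 < (Real.log 2)⁻¹ := inv_pos.2 (Real.log_pos (by norm_num))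
  refine (Real.tendsto_log_nhdsGT_zero.atBot_mul_const h).congr fun x => ?_
  rw [Real.logb, div_eq_mul_inv]

/-- As δ → 0, positive weight of ω on the kernel of σ would drive the regularised term to -∞,
against the uniform bound. With no such weight the terms converge to those of `trLog`. -/
theorem suppLE_and_le_trLog_of_le_regTrLog {ω σ : Matrix n n ℂ} (hω : ω.PosSemidef)
    (hσ : σ.PosSemidef) {c : ℝ} (h : ∀ δ, 0 < δ → c ≤ regTrLog δ ω σ) :
    SuppLE ω σ ∧ c ≤ trLog ω σ := by
  obtain ⟨U, d, h1, h2, rfl, hd⟩ := exists_unitary_rdiag_nonneg hσ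
  simp only [regTrLog_conj_rdiag _ _ U h1 h2 hd] at h
  have hc := conj_diag_re_nonneg hω U
  have hs : ∀ j, d j = 0 → ((Uᴴ * ω * U) j j).re = 0 := by
    intro k hk
    by_contra hne
    have hpos : 0 < ((Uᴴ * ω * U) k k).re := lt_of_le_of_ne (hc k) (Ne.symm hne)
    -- The other terms are bounded by their values at δ = 1, so a small δ < 1 makes the k-th term
    -- alone violate the bound.
    have h3 := (tendsto_logb_nhdsGT_zero.const_mul_atBot hpos).eventually
      (eventually_lt_atBot
        (c - ∑ j ∈ Finset.univ.erase k, ((Uᴴ * ω * U) j j).re * Real.logb 2 (d j + 1)))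
    obtain ⟨δ, ⟨hδ, hδ0⟩, hδ1⟩ := ((h3.and self_mem_nhdsWithin).and
      (mem_nhdsWithin_of_mem_nhds (Iio_mem_nhds one_pos))).exists
    have hδ0 : 0 < δ := hδ0
    have hδ1 : δ < 1 := hδ1
    have h4 := h δ hδ0
    rw [← Finset.add_sum_erase _ _ (Finset.mem_univ k), hk, zero_add] at h4
    have h5 : ∑ j ∈ Finset.univ.erase k, ((Uᴴ * ω * U) j j).re * Real.logb 2 (d j + δ) ≤
        ∑ j ∈ Finset.univ.erase k, ((Uᴴ * ω * U) j j).re * Real.logb 2 (d j + 1) := by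
      refine Finset.sum_le_sum fun j _ => mul_le_mul_of_nonneg_left ?_ (hc j)
      exact Real.logb_le_logb_of_le (by norm_num) (by linarith [hd j]) (by linarith)
    linarith
  refine ⟨(suppLE_conj_rdiag_iff hω U h1 h2 d).2 hs, ?_⟩
  rw [trLog_conj_rdiag _ U h1 h2]
  have hlim : Tendsto (fun δ => ∑ j, ((Uᴴ * ω * U) j j).re * Real.logb 2 (d j + δ)) (𝓝[>] 0)
      (𝓝 (∑ j, ((Uᴴ * ω * U) j j).re * Real.logb 2 (d j))) := by
    refine tendsto_finsetSum _ fun j _ => ?_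
    rcases (hd j).eq_or_lt with hj | hj
    · simp only [hs j hj.symm, zero_mul]; exact tendsto_const_nhds
    · refine Tendsto.const_mul _ (tendsto_nhdsWithin_of_tendsto_nhds ?_)
      have h6 : ContinuousAt (fun δ => Real.logb 2 (d j + δ)) 0 := by
        simp only [Real.logb]
        exact (ContinuousAt.log (by fun_prop) (by simpa using hj.ne')).div_const _
      simpa using h6.tendsto
  exact ge_of_tendsto hlim (by filter_upwards [self_mem_nhdsWithin] with δ hδ using h δ hδ)

/-- Lower semicontinuity of the relative entropy in the second argument. -/
theorem relEntropy_le_of_tendsto {X : Type*} {l : Filter X} [l.NeBot] {ω σ : Matrix n n ℂ}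
    {σ' : X → Matrix n n ℂ} (hω : ω.PosSemidef) (hσ : σ.PosSemidef) (hlim : Tendsto σ' l (𝓝 σ))
    {M : ℝ} (h : ∀ᶠ x in l, (σ' x).PosSemidef ∧ relEntropy ω (σ' x) ≤ (M : EReal)) :
    relEntropy ω σ ≤ (M : EReal) := by
  -- For fixed δ the regularised term is continuous in σ and dominates `trLog`, so the limit in σ is
  -- taken before δ → 0.
  have key (δ : ℝ) (hδ : 0 < δ) : negEntropy ω - M ≤ regTrLog δ ω σ := by
    have h1 : Tendsto (fun x => regTrLog δ ω (σ' x)) l (𝓝 (regTrLog δ ω σ)) := by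
      refine ((continuousOn_regTrLog hδ ω) σ hσ.1).tendsto.comp ?_
      rw [tendsto_nhdsWithin_iff]
      exact ⟨hlim, h.mono fun x hx => hx.1.1⟩
    refine ge_of_tendsto h1 ?_
    filter_upwards [h] with x hx
    have hs : SuppLE ω (σ' x) := by
      by_contra hn
      rw [relEntropy_of_not_suppLE hn] at hx
      exact absurd hx.2 (not_le.2 (EReal.coe_lt_top _))
    have h2 := hx.2
    rw [relEntropy_of_suppLE hs, EReal.coe_le_coe_iff] at h2
    have := trLog_le_regTrLog hδ hω hx.1 hs
    linarith
  obtain ⟨hs, hle⟩ := suppLE_and_le_trLog_of_le_regTrLog hω hσ key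
  rw [relEntropy_of_suppLE hs, EReal.coe_le_coe_iff]
  linarith

end Continuity

/-! ### Carathéodory's theorem and compact convex hulls. -/

section ConvexHull

variable {E : Type*} [AddCommGroup E] [Module ℝ E]

/-- The affinely independent family of Carathéodory's theorem is padded with zero weights to a
length independent of x. The hull is then a continuous image of a simplex times a power of K, which
gives compactness. -/
theorem mem_convexHull_iff_exists_fin [FiniteDimensional ℝ E] {K : Set E} {x : E} :
    x ∈ convexHull ℝ K ↔ ∃ (p : Fin (Module.finrank ℝ E + 1) → ℝ)
      (z : Fin (Module.finrank ℝ E + 1) → E),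
      IsDistribution p ∧ (∀ i, z i ∈ K) ∧ ∑ i, p i • z i = x := by
  constructor
  · intro hx
    obtain ⟨z0, hz0⟩ : K.Nonempty := convexHull_nonempty_iff.1 ⟨x, hx⟩
    obtain ⟨ι, _, z, p, hz, haff, hp, hp1, rfl⟩ := eq_pos_convex_span_of_mem_convexHull hx
    have hcard : Fintype.card ι ≤ Fintype.card (Fin (Module.finrank ℝ E + 1)) := by
      rw [Fintype.card_fin]
      exact haff.card_le_finrank_succ.trans
        (Nat.succ_le_succ (Submodule.finrank_le _))
    obtain ⟨e⟩ := Function.Embedding.nonempty_of_card_le hcard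
    have hpe (i) (hi : i ∉ Set.range e) : Function.extend e p 0 i = 0 :=
      Function.extend_apply' _ _ _ hi
    refine ⟨Function.extend e p 0, Function.extend e z fun _ => z0, ⟨fun i => ?_, ?_⟩,
      fun i => ?_, ?_⟩
    · by_cases hi : i ∈ Set.range e
      · obtain ⟨j, rfl⟩ := hi
        rw [e.injective.extend_apply]; exact (hp j).le
      · rw [hpe i hi]
    · rw [← hp1]
      exact (Fintype.sum_of_injective e e.injective _ _ hpe
        fun j => (e.injective.extend_apply _ _ j).symm).symm
    · by_cases hi : i ∈ Set.range e
      · obtain ⟨j, rfl⟩ := hi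
        rw [e.injective.extend_apply]; exact hz ⟨j, rfl⟩
      · rw [Function.extend_apply' _ _ _ hi]; exact hz0
    · refine (Fintype.sum_of_injective e e.injective _ _ (fun i hi => ?_) fun j => ?_).symm
      · rw [hpe i hi, zero_smul]
      · rw [e.injective.extend_apply, e.injective.extend_apply]
  · rintro ⟨p, z, hp, hz, rfl⟩
    exact (convex_convexHull ℝ K).sum_mem (fun i _ => hp.1 i) hp.2
      fun i _ => subset_convexHull ℝ K (hz i)

theorem isCompact_convexHull_of_finiteDimensional [TopologicalSpace E] [IsTopologicalAddGroup E]
    [ContinuousSMul ℝ E] [FiniteDimensional ℝ E] {K : Set E} (hK : IsCompact K) :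
    IsCompact (convexHull ℝ K) := by
  let ι := Fin (Module.finrank ℝ E + 1)
  have h : convexHull ℝ K = (fun q : (ι → ℝ) × (ι → E) => ∑ i, q.1 i • q.2 i) ''
      (stdSimplex ℝ ι ×ˢ Set.univ.pi fun _ => K) := by
    ext x
    rw [mem_convexHull_iff_exists_fin]
    constructor
    · rintro ⟨p, z, hp, hz, rfl⟩
      exact ⟨(p, z), ⟨hp, fun i _ => hz i⟩, rfl⟩
    · rintro ⟨⟨p, z⟩, ⟨hp, hz⟩, rfl⟩
      exact ⟨p, z, hp, fun i => hz i trivial, rfl⟩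
  rw [h]
  refine ((isCompact_stdSimplex ℝ ι).prod (isCompact_univ_pi fun _ => hK)).image ?_
  fun_prop

end ConvexHull

/-! ### The abstract minimax theorem. -/

section Minimax

variable {n : Type v} [Fintype n] [DecidableEq n] {T : Type w}

/-- The values `∑ₓ p(x) h(tₓ) - Tr[m log₂ m]`, `m = ∑ₓ p(x) F(tₓ)`, over all finite ensembles. -/
def ensembleValues (F : T → Matrix n n ℂ) (h : T → ℝ) : Set EReal :=
  {v | ∃ (k : ℕ) (p : Fin k → ℝ) (t : Fin k → T), IsDistribution p ∧
    v = ((∑ x, p x * h (t x) - negEntropy (∑ x, (p x : ℂ) • F (t x)) : ℝ) : EReal)}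

theorem trLog_add_left (A B C : Matrix n n ℂ) : trLog (A + B) C = trLog A C + trLog B C := by
  rw [trLog, Matrix.add_mul, trace_add, Complex.add_re]; rfl

theorem trLog_smul_left (r : ℝ) (A C : Matrix n n ℂ) : trLog (r • A) C = r * trLog A C := by
  rw [trLog, Matrix.smul_mul, trace_smul, Complex.smul_re]; rfl

theorem trLog_sum_left {ι : Type*} (s : Finset ι) (A : ι → Matrix n n ℂ) (C : Matrix n n ℂ) :
    trLog (∑ i ∈ s, A i) C = ∑ i ∈ s, trLog (A i) C := by
  simp only [trLog, Matrix.sum_mul, trace_sum, Complex.re_sum]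

theorem continuous_trLog_left (C : Matrix n n ℂ) : Continuous fun A => trLog A C :=
  Complex.continuous_re.comp
    ((continuous_id.matrix_mul continuous_const).matrix_trace)

theorem posSemidef_real_smul {A : Matrix n n ℂ} (hA : A.PosSemidef) {r : ℝ} (hr : 0 ≤ r) :
    (r • A).PosSemidef := by
  have : r • A = (r : ℂ) • A := (Complex.coe_smul r A).symm
  rw [this]
  exact hA.smul (by exact_mod_cast hr)

/-- The number h(t) is left free so that one statement serves all four quantities. Where supports
allow, the payoff equals h(t) - Tr[F(t) log σ], which is linear in the pair (F(t), h(t));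
compactness thus gives the inner maxima, and a failing support gives `⊤`. -/
theorem ensemble_isMinMax [Nonempty T] {F : T → Matrix n n ℂ} {h : T → ℝ}
    (hF : ∀ t, (F t).PosSemidef) (htr : ∀ t, (F t).trace = 1)
    (hK : IsCompact (Set.range fun t => (F t, h t))) :
    ∃ M : ℝ, IsGreatest (ensembleValues F h) M ∧
      IsMinMax (fun (σ : State n) (t : T) =>
        ((h t - negEntropy (F t) : ℝ) : EReal) + relEntropy (F t) σ.mat) M := by
  set K : Set (Matrix n n ℂ × ℝ) := Set.range fun t => (F t, h t) with hKdef
  have hKne : K.Nonempty := Set.range_nonempty _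
  have hC := isCompact_convexHull_of_finiteDimensional hK
  have hS : Convex ℝ {z : Matrix n n ℂ × ℝ | z.1.PosSemidef ∧ z.1.trace = 1} := by
    rintro x ⟨hx, hx1⟩ y ⟨hy, hy1⟩ a b ha hb hab
    refine ⟨(posSemidef_real_smul hx ha).add (posSemidef_real_smul hy hb), ?_⟩
    change (a • x.1 + b • y.1).trace = 1
    rw [trace_add, trace_smul, trace_smul, hx1, hy1, ← add_smul, hab, one_smul]
  have hCS : convexHull ℝ K ⊆ {z | z.1.PosSemidef ∧ z.1.trace = 1} := by
    refine convexHull_min ?_ hS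
    rintro _ ⟨t, rfl⟩
    exact ⟨hF t, htr t⟩
  have hcont : ContinuousOn (fun z : Matrix n n ℂ × ℝ => z.2 - negEntropy z.1)
      (convexHull ℝ K) := by
    refine continuousOn_snd.sub (continuousOn_negEntropy.comp continuousOn_fst ?_)
    exact fun z hz => (hCS hz).1.1
  obtain ⟨z, hzC, hz⟩ := hC.exists_isMaxOn (convexHull_nonempty_iff.2 hKne) hcont
  have hz' : ∀ y ∈ convexHull ℝ K, y.2 - negEntropy y.1 ≤ z.2 - negEntropy z.1 := fun y hy => hz hy
  obtain ⟨hz1, hz2⟩ := hCS hzC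
  obtain ⟨p, q, hp, hq, hpq⟩ := mem_convexHull_iff_exists_fin.1 hzC
  choose t ht using hq
  have hsum1 : ∑ x, (p x : ℂ) • F (t x) = z.1 := by
    rw [← hpq, Prod.fst_sum]
    refine Finset.sum_congr rfl fun i _ => ?_
    rw [← ht i]; exact Complex.coe_smul _ _
  have hsum2 : ∑ x, p x * h (t x) = z.2 := by
    rw [← hpq, Prod.snd_sum]
    refine Finset.sum_congr rfl fun i _ => ?_
    rw [← ht i]; rfl
  refine ⟨z.2 - negEntropy z.1, ⟨⟨_, p, t, hp, by rw [hsum1, hsum2]⟩, ?_⟩, ?_⟩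
  · rintro _ ⟨k, p', t', hp', rfl⟩
    rw [EReal.coe_le_coe_iff]
    have hmem : ∑ x, p' x • (F (t' x), h (t' x)) ∈ convexHull ℝ K :=
      (convex_convexHull ℝ K).sum_mem (fun i _ => hp'.1 i) hp'.2
        fun i _ => subset_convexHull ℝ K ⟨t' i, rfl⟩
    have := hz' _ hmem
    rw [Prod.fst_sum, Prod.snd_sum] at this
    simp only [Complex.coe_smul]
    exact this
  -- Optimality of σ = z₁. The perturbed points have supports containing that of F(t0), so their
  -- relative entropies are finite, and semicontinuity covers the limit.
  have hub (t0 : T) : ((h t0 - negEntropy (F t0) : ℝ) : EReal) + relEntropy (F t0) z.1 ≤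
      ((z.2 - negEntropy z.1 : ℝ) : EReal) := by
    have hle : relEntropy (F t0) z.1 ≤
        ((z.2 - negEntropy z.1 - (h t0 - negEntropy (F t0)) : ℝ) : EReal) := by
      have hlim : Tendsto (fun ε : ℝ => ε • F t0 + (1 - ε) • z.1) (𝓝[>] 0) (𝓝 z.1) := by
        have hc : Continuous fun ε : ℝ => ε • F t0 + (1 - ε) • z.1 := by fun_prop
        have := hc.tendsto 0
        simp only [zero_smul, zero_add, sub_zero, one_smul] at this
        exact tendsto_nhdsWithin_of_tendsto_nhds this
      refine relEntropy_le_of_tendsto (hF t0) hz1 hlim ?_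
      filter_upwards [self_mem_nhdsWithin, mem_nhdsWithin_of_mem_nhds (Iio_mem_nhds one_pos)]
        with ε hε0 hε1
      have hε0 : 0 < ε := hε0
      have hε1 : 0 < 1 - ε := sub_pos.2 hε1
      have hA := posSemidef_real_smul (hF t0) hε0.le
      have hB := posSemidef_real_smul hz1 hε1.le
      have hm := hA.add hB
      have hs1 : SuppLE (F t0) (ε • F t0 + (1 - ε) • z.1) := by
        intro v hv
        have := SuppLE.add_right hA hB v hv
        rw [smul_mulVec] at this
        exact (smul_eq_zero.1 this).resolve_left hε0.ne'
      have hs2 : SuppLE z.1 (ε • F t0 + (1 - ε) • z.1) := by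
        intro v hv
        rw [add_comm] at hv
        have := SuppLE.add_right hB hA v hv
        rw [smul_mulVec] at this
        exact (smul_eq_zero.1 this).resolve_left hε1.ne'
      refine ⟨hm, ?_⟩
      rw [relEntropy_of_suppLE hs1, EReal.coe_le_coe_iff]
      have hmem : ε • (F t0, h t0) + (1 - ε) • z ∈ convexHull ℝ K :=
        (convex_convexHull ℝ K) (subset_convexHull ℝ K ⟨t0, rfl⟩) hzC hε0.le hε1.le (by ring)
      have h1 := hz' _ hmem
      have h2 : negEntropy (ε • F t0 + (1 - ε) • z.1) = ε * trLog (F t0) (ε • F t0 + (1 - ε) • z.1)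
          + (1 - ε) * trLog z.1 (ε • F t0 + (1 - ε) • z.1) := by
        rw [negEntropy, trLog_add_left, trLog_smul_left, trLog_smul_left]
      have h3 := trLog_le_negEntropy hz1 hm (by
        rw [trace_add, trace_smul, trace_smul, htr, hz2, ← add_smul]; simp) hs2
      simp only [Prod.fst_add, Prod.smul_fst, Prod.snd_add, Prod.smul_snd, smul_eq_mul, h2] at h1
      -- Maximality of z at the perturbed point, with Klein's inequality for the share 1 - ε of z,
      -- leaves an inequality of order ε to be divided by ε.
      have h4 : ε * (h t0 - trLog (F t0) (ε • F t0 + (1 - ε) • z.1)) ≤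
          ε * (z.2 - negEntropy z.1) := by nlinarith
      have h5 := le_of_mul_le_mul_left h4 hε0
      linarith
    calc _ ≤ ((h t0 - negEntropy (F t0) : ℝ) : EReal) +
          ((z.2 - negEntropy z.1 - (h t0 - negEntropy (F t0)) : ℝ) : EReal) := add_le_add_right hle _
      _ = _ := by rw [← EReal.coe_add]; congr 1; ring
  have hreal (σ : State n) (t0 : T) (hs : SuppLE (F t0) σ.mat) :
      ((h t0 - negEntropy (F t0) : ℝ) : EReal) + relEntropy (F t0) σ.mat =
        ((h t0 - trLog (F t0) σ.mat : ℝ) : EReal) := by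
    rw [relEntropy_of_suppLE hs, ← EReal.coe_add]; congr 1; ring
  have htop (σ : State n) (t0 : T) (hs : ¬ SuppLE (F t0) σ.mat) :
      ((h t0 - negEntropy (F t0) : ℝ) : EReal) + relEntropy (F t0) σ.mat = ⊤ := by
    rw [relEntropy_of_not_suppLE hs, EReal.coe_add_top]
  have hex (σ : State n) : ∃ g, IsGreatest (Set.range fun t0 =>
      ((h t0 - negEntropy (F t0) : ℝ) : EReal) + relEntropy (F t0) σ.mat) g := by
    by_cases hall : ∀ t0, SuppLE (F t0) σ.mat
    · have hc : Continuous fun y : Matrix n n ℂ × ℝ => y.2 - trLog y.1 σ.mat :=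
        continuous_snd.sub ((continuous_trLog_left σ.mat).comp continuous_fst)
      obtain ⟨_, ⟨t0, rfl⟩, hmax⟩ := hK.exists_isMaxOn hKne hc.continuousOn
      refine ⟨_, ⟨t0, rfl⟩, ?_⟩
      rintro _ ⟨t1, rfl⟩
      simp only
      rw [hreal σ t0 (hall t0), hreal σ t1 (hall t1), EReal.coe_le_coe_iff]
      exact hmax ⟨t1, rfl⟩
    · obtain ⟨t0, ht0⟩ := not_forall.1 hall
      exact ⟨⊤, ⟨t0, htop σ t0 ht0⟩, fun _ _ => le_top⟩
  choose g hg using hex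
  -- The maximum over t dominates the average over the ensemble of z, and Klein's inequality
  -- compares Tr[z₁ log σ] with Tr[z₁ log z₁].
  have hlow (σ : State n) : ((z.2 - negEntropy z.1 : ℝ) : EReal) ≤ g σ := by
    by_cases hall : ∀ t0, SuppLE (F t0) σ.mat
    · obtain ⟨t0, ht0⟩ := (hg σ).1
      simp only at ht0
      rw [hreal σ t0 (hall t0)] at ht0
      have hle (t1 : T) : h t1 - trLog (F t1) σ.mat ≤ h t0 - trLog (F t0) σ.mat := by
        have := (hg σ).2 ⟨t1, rfl⟩
        simp only at this
        rwa [hreal σ t1 (hall t1), ← ht0, EReal.coe_le_coe_iff] at this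
      have hs : SuppLE z.1 σ.mat := by
        intro v hv
        rw [← hsum1, sum_mulVec]
        refine Finset.sum_eq_zero fun x _ => ?_
        rw [smul_mulVec, hall (t x) v hv, smul_zero]
      have h1 := trLog_le_negEntropy hz1 σ.posSemidef (hz2.trans σ.trace_eq_one.symm) hs
      have h2 : trLog z.1 σ.mat = ∑ x, p x * trLog (F (t x)) σ.mat := by
        rw [← hsum1, trLog_sum_left]
        refine Finset.sum_congr rfl fun x _ => ?_
        rw [Complex.coe_smul, trLog_smul_left]
      rw [← ht0, EReal.coe_le_coe_iff]
      calc z.2 - negEntropy z.1 ≤ z.2 - trLog z.1 σ.mat := by linarith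
        _ = ∑ x, p x * (h (t x) - trLog (F (t x)) σ.mat) := by
          rw [h2, ← hsum2, ← Finset.sum_sub_distrib]
          exact Finset.sum_congr rfl fun x _ => by ring
        _ ≤ ∑ x, p x * (h t0 - trLog (F t0) σ.mat) :=
          Finset.sum_le_sum fun x _ => mul_le_mul_of_nonneg_left (hle _) (hp.1 x)
        _ = _ := by rw [← Finset.sum_mul, hp.2, one_mul]
    · obtain ⟨t0, ht0⟩ := not_forall.1 hall
      have := (hg σ).2 ⟨t0, rfl⟩
      simp only at this
      rw [htop σ t0 ht0] at this
      exact le_top.trans this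
  refine ⟨g, hg, ⟨⟨z.1, hz1, hz2⟩, le_antisymm ?_ (hlow _)⟩, ?_⟩
  · obtain ⟨t0, ht0⟩ := (hg ⟨z.1, hz1, hz2⟩).1
    rw [← ht0]
    exact hub t0
  · rintro _ ⟨σ, rfl⟩
    exact hlow σ

end Minimax

/-! ### Compactness of the set of states. -/

section StateSpace

variable {n : Type v} [Fintype n] [DecidableEq n]

theorem norm_apply_le_trace {A : Matrix n n ℂ} (hA : A.PosSemidef) (i j : n) :
    ‖A i j‖ ≤ A.trace.re := by
  obtain ⟨U, d, h1, h2, rfl, hd⟩ := exists_unitary_rdiag_nonneg hA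
  have hU (i k : n) : ‖U i k‖ ≤ 1 := entry_norm_bound_of_unitary (mem_unitaryGroup_iff.2 h2) i k
  rw [trace_conj_rdiag h1, mul_apply]
  refine (norm_sum_le _ _).trans (Finset.sum_le_sum fun k _ => ?_)
  rw [mul_diagonal, conjTranspose_apply, norm_mul, norm_mul, norm_star, Complex.norm_real,
    Real.norm_of_nonneg (hd k)]
  calc ‖U i k‖ * d k * ‖U j k‖ ≤ 1 * d k * 1 := by
        gcongr
        · exact mul_nonneg zero_le_one (hd k)
        · exact hd k
        · exact hU i k
        · exact hU j k
    _ = d k := by ring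

theorem isClosed_posSemidef : IsClosed {A : Matrix n n ℂ | A.PosSemidef} := by
  have : {A : Matrix n n ℂ | A.PosSemidef} =
      {A | Aᴴ = A} ∩ ⋂ x : n → ℂ, {A | 0 ≤ star x ⬝ᵥ (A *ᵥ x)} := by
    ext A
    simp only [Set.mem_ofPred_eq, Set.mem_inter_iff, Set.mem_iInter,
      posSemidef_iff_dotProduct_mulVec]
    rfl
  rw [this]
  refine (isClosed_eq (by fun_prop) continuous_id).inter (isClosed_iInter fun x => ?_)
  exact isClosed_le continuous_const (by fun_prop)

theorem isCompact_matrix_closedBall {m : Type u} {n : Type v} (c : ℝ) :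
    IsCompact {A : Matrix m n ℂ | ∀ i j, ‖A i j‖ ≤ c} := by
  have h : IsCompact (Set.univ.pi fun _ : m => Set.univ.pi fun _ : n =>
      Metric.closedBall (0 : ℂ) c) :=
    isCompact_univ_pi fun _ => isCompact_univ_pi fun _ => isCompact_closedBall _ _
  change IsCompact {A : m → n → ℂ | ∀ i j, ‖A i j‖ ≤ c}
  convert h using 1
  ext A
  simp [Set.mem_pi]

theorem isCompact_states : IsCompact {A : Matrix n n ℂ | A.PosSemidef ∧ A.trace = 1} := by
  refine (isCompact_matrix_closedBall (m := n) (n := n) 1).of_isClosed_subset ?_ ?_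
  · exact isClosed_posSemidef.inter (isClosed_eq (continuous_id.matrix_trace) continuous_const)
  · rintro A ⟨hA, ht⟩ i j
    have := norm_apply_le_trace hA i j
    rwa [ht, Complex.one_re] at this

theorem range_state_mat :
    Set.range (fun ρ : State n => ρ.mat) = {A : Matrix n n ℂ | A.PosSemidef ∧ A.trace = 1} := by
  ext A
  constructor
  · rintro ⟨ρ, rfl⟩
    exact ⟨ρ.posSemidef, ρ.trace_eq_one⟩
  · rintro ⟨hA, ht⟩
    exact ⟨⟨A, hA, ht⟩, rfl⟩

instance [Nonempty n] : Nonempty (State n) :=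
  ⟨⟨single (Classical.arbitrary n) (Classical.arbitrary n) 1, posSemidef_single_one _, by simp⟩⟩

end StateSpace

/-! ### Channels on arbitrary reference systems, and compactness of the set of channels. -/

section Channels

variable {a : Type u} {b : Type v} {r : Type w} [Fintype a] [Fintype b] [Fintype r]
  (N : Channel a b)

theorem posSemidef_tensorId {M : Matrix (a × r) (a × r) ℂ} (hM : M.PosSemidef) :
    (tensorId N.map M).PosSemidef := by
  let e := Fintype.equivFin r
  have h := (N.completelyPositive _ _ (hM.submatrix (Prod.map id e.symm))).submatrix
    (Prod.map id e)
  convert h using 1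
  ext p q
  simp [tensorId]

theorem marginalFst_tensorId (M : Matrix (a × r) (a × r) ℂ) :
    marginalFst (tensorId N.map M) = N.map (marginalFst M) := by
  have : marginalFst M = ∑ j, Matrix.of fun i i' => M (i, j) (i', j) := by
    ext i i'; simp [marginalFst, Matrix.sum_apply]
  rw [this, map_sum]
  ext i i'
  rw [Matrix.sum_apply]
  rfl

theorem marginalSnd_tensorId (M : Matrix (a × r) (a × r) ℂ) :
    marginalSnd (tensorId N.map M) = marginalSnd M := by
  ext j j'
  exact N.tracePreserving (fun i i' => M (i, j) (i', j'))

theorem trace_tensorId (M : Matrix (a × r) (a × r) ℂ) :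
    (tensorId N.map M).trace = M.trace := by
  classical
  rw [← trace_marginalSnd, marginalSnd_tensorId, trace_marginalSnd]

theorem posSemidef_map {M : Matrix a a ℂ} (hM : M.PosSemidef) : (N.map M).PosSemidef := by
  have h := (posSemidef_tensorId N (hM.submatrix (Prod.fst : a × Unit → a))).submatrix
    (fun i : b => (i, ()))
  exact h

theorem continuous_channel_map : Continuous fun M : Matrix a a ℂ => N.map M :=
  N.map.continuous_of_finiteDimensional

theorem continuous_tensorId_channel :
    Continuous fun M : Matrix (a × r) (a × r) ℂ => tensorId N.map M := by
  refine continuous_pi fun p => continuous_pi fun q => ?_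
  have h1 : Continuous fun M : Matrix (a × r) (a × r) ℂ =>
      (fun i i' => M (i, p.2) (i', q.2) : Matrix a a ℂ) :=
    continuous_pi fun i => continuous_pi fun i' => continuous_apply_apply _ _
  exact (continuous_apply_apply p.1 q.1).comp ((continuous_channel_map N).comp h1)

/-- The linear map with prescribed values on matrix units. -/
def mapOfUnits (C : a → a → Matrix b b ℂ) : Matrix a a ℂ →ₗ[ℂ] Matrix b b ℂ where
  toFun M := ∑ k, ∑ l, M k l • C k l
  map_add' M M' := by simp [add_smul, Finset.sum_add_distrib]
  map_smul' c M := by simp [Finset.smul_sum, smul_smul]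

theorem mapOfUnits_apply_single [DecidableEq a] (L : Matrix a a ℂ →ₗ[ℂ] Matrix b b ℂ) :
    mapOfUnits (fun k l => L (single k l 1)) = L := by
  ext1 M
  conv_rhs => rw [matrix_eq_sum_single M]
  simp only [mapOfUnits, LinearMap.coe_mk, AddHom.coe_mk, map_sum]
  refine Finset.sum_congr rfl fun k _ => Finset.sum_congr rfl fun l _ => ?_
  rw [← map_smul, smul_single, smul_eq_mul, mul_one]

theorem single_mapOfUnits [DecidableEq a] (C : a → a → Matrix b b ℂ) (k l : a) :
    mapOfUnits C (single k l 1) = C k l := by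
  simp only [mapOfUnits, LinearMap.coe_mk, AddHom.coe_mk]
  rw [Finset.sum_eq_single k, Finset.sum_eq_single l]
  · simp
  · intro l' _ hl; simp [hl.symm]
  · simp
  · intro k' _ hk
    exact Finset.sum_eq_zero fun l' _ => by simp [hk.symm]
  · simp

theorem continuous_mapOfUnits (M : Matrix a a ℂ) :
    Continuous fun C : a → a → Matrix b b ℂ => mapOfUnits C M := by
  simp only [mapOfUnits, LinearMap.coe_mk, AddHom.coe_mk]
  fun_prop

theorem continuous_tensorId_mapOfUnits (M : Matrix (a × r) (a × r) ℂ) :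
    Continuous fun C : a → a → Matrix b b ℂ => tensorId (mapOfUnits C) M :=
  continuous_pi fun p => continuous_pi fun q =>
    (continuous_apply_apply p.1 q.1).comp (continuous_mapOfUnits _)

theorem tensorId_maximallyEntangled [DecidableEq a] (L : Matrix a a ℂ →ₗ[ℂ] Matrix b b ℂ)
    (p q : b × a) :
    tensorId L (vecMulVec (fun t : a × a => if t.1 = t.2 then (1 : ℂ) else 0)
      (star fun t : a × a => if t.1 = t.2 then (1 : ℂ) else 0)) p q =
      L (single p.2 q.2 1) p.1 q.1 := by
  refine congrArg (fun A => L A p.1 q.1) ?_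
  ext i i'
  simp only [vecMulVec_apply, Pi.star_apply, single_apply, eq_comm (a := p.2), eq_comm (a := q.2)]
  by_cases h1 : i = p.2 <;> by_cases h2 : i' = q.2 <;> simp [h1, h2]

/-- The values on matrix units of quantum channels. -/
def channelUnits (a : Type u) (b : Type v) [Fintype a] [Fintype b] :
    Set (a → a → Matrix b b ℂ) :=
  {C | (∀ (k : ℕ) (M : Matrix (a × Fin k) (a × Fin k) ℂ),
    M.PosSemidef → (tensorId (mapOfUnits C) M).PosSemidef) ∧
    ∀ M : Matrix a a ℂ, (mapOfUnits C M).trace = M.trace}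

/-- Each defining condition is closed. Boundedness comes from the Choi matrix, which is positive
semidefinite with trace `Fintype.card a`, so its entries are at most that number in norm. -/
theorem isCompact_channelUnits : IsCompact (channelUnits a b) := by
  classical
  have hB : IsCompact (Set.univ.pi fun _ : a => Set.univ.pi fun _ : a =>
      {A : Matrix b b ℂ | ∀ i j, ‖A i j‖ ≤ Fintype.card a}) :=
    isCompact_univ_pi fun _ => isCompact_univ_pi fun _ => isCompact_matrix_closedBall _
  refine hB.of_isClosed_subset ?_ ?_
  · have : channelUnits a b = (⋂ (k : ℕ) (M : Matrix (a × Fin k) (a × Fin k) ℂ)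
        (_ : M.PosSemidef), {C | (tensorId (mapOfUnits C) M).PosSemidef}) ∩
        ⋂ M : Matrix a a ℂ, {C | (mapOfUnits C M).trace = M.trace} := by
      ext C; simp [channelUnits]
    rw [this]
    refine (isClosed_iInter fun k => isClosed_iInter fun M => isClosed_iInter fun _ => ?_).inter
      (isClosed_iInter fun M => ?_)
    · exact isClosed_posSemidef.preimage (continuous_tensorId_mapOfUnits M)
    · exact isClosed_eq (continuous_mapOfUnits M).matrix_trace continuous_const
  · rintro C ⟨hC1, hC2⟩ k _ l _ i j
    let E : Channel a b := ⟨mapOfUnits C, hC1, hC2⟩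
    have h1 := norm_apply_le_trace (posSemidef_tensorId E
      (posSemidef_vecMulVec_self_star fun t : a × a => if t.1 = t.2 then (1 : ℂ) else 0))
      (i, k) (j, l)
    rw [tensorId_maximallyEntangled, trace_tensorId, single_mapOfUnits] at h1
    refine h1.trans (le_of_eq ?_)
    simp [trace, vecMulVec_apply, Fintype.sum_prod_type]

instance [Nonempty b] : Nonempty (Channel a b) := by
  classical
  let b0 := Classical.arbitrary b
  refine ⟨⟨(traceLinearMap a ℂ ℂ).smulRight (single b0 b0 1), fun k M hM => ?_, fun M => ?_⟩⟩
  · have : tensorId ((traceLinearMap a ℂ ℂ).smulRight (single b0 b0 1)) M =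
        single b0 b0 1 ⊗ₖ marginalSnd M := by
      ext p q
      change (Matrix.of fun i i' => M (i, p.2) (i', q.2)).trace * single b0 b0 1 p.1 q.1 = _
      rw [mul_comm]
      rfl
    rw [this]
    exact (posSemidef_single_one b0).kronecker (posSemidef_marginalSnd hM)
  · simp

end Channels

/-! ### The Holevo information. -/

section Holevo

variable {a : Type u} {b : Type v} [Fintype a] [Nonempty a] [Fintype b] [DecidableEq b]
  (N : Channel a b)

theorem trace_map_state (ρ : State a) : (N.map ρ.mat).trace = 1 :=
  (N.tracePreserving _).trans ρ.trace_eq_one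

theorem holevo_isMinMax :
    IsGreatest (holevoValues N) (holevoInformation N) ∧
      IsMinMax (fun (σ : State b) (ρ : State a) => relEntropy (N.map ρ.mat) σ.mat)
        (holevoInformation N) := by
  classical
  have hpsd (ρ : State a) : (N.map ρ.mat).PosSemidef := posSemidef_map N ρ.posSemidef
  have hK : IsCompact (Set.range fun ρ : State a => (N.map ρ.mat, negEntropy (N.map ρ.mat))) := by
    have h := (isCompact_states (n := a)).image_of_continuousOn
      (f := fun A => (N.map A, negEntropy (N.map A))) ?_
    · rw [← range_state_mat, ← Set.range_comp] at h
      exact h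
    · have hc := (continuous_channel_map N).continuousOn (s := {A | A.PosSemidef ∧ A.trace = 1})
      exact hc.prodMk (continuousOn_negEntropy.comp hc fun A hA => (posSemidef_map N hA.1).1)
  obtain ⟨M, hM, hMM⟩ := ensemble_isMinMax (T := State a) hpsd (trace_map_state N) hK
  have hval : holevoValues N =
      ensembleValues (fun ρ : State a => N.map ρ.mat) fun ρ => negEntropy (N.map ρ.mat) := by
    ext v
    refine exists_congr fun k => exists_congr fun p => exists_congr fun t =>
      and_congr_right fun hp => ?_
    rw [mutualInformation_cqState hp.1 (fun x => hpsd (t x)) fun x => trace_map_state N (t x)]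
  have hI : holevoInformation N = M := by
    rw [holevoInformation, hval]; exact hM.isLUB.sSup_eq
  rw [hI, hval]
  refine ⟨hM, ?_⟩
  simpa only [sub_self, EReal.coe_zero, zero_add] using hMM

end Holevo

/-! ### The two assisted quantities. -/

section Assisted

variable {a : Type*} {b : Type*} {ea : Type*} {eb : Type*} [Fintype a] [Nonempty a] [Fintype b]
  [DecidableEq b] [Fintype ea] [Fintype eb] [DecidableEq eb] (N : Channel a b)
  (ρ : State (ea × eb))

theorem posSemidef_encodedOutput (E : Channel ea a) : (encodedOutput N ρ E).PosSemidef :=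
  posSemidef_tensorId N (posSemidef_tensorId E ρ.posSemidef)

theorem trace_encodedOutput (E : Channel ea a) : (encodedOutput N ρ E).trace = 1 :=
  (trace_tensorId N (tensorId E.map ρ.mat)).trans
    ((trace_tensorId E ρ.mat).trans ρ.trace_eq_one)

theorem marginalSnd_encodedOutput (E : Channel ea a) :
    marginalSnd (encodedOutput N ρ E) = marginalSnd ρ.mat :=
  (marginalSnd_tensorId N (tensorId E.map ρ.mat)).trans (marginalSnd_tensorId E ρ.mat)

theorem isCompact_range_encodedOutput : IsCompact (Set.range (encodedOutput N ρ)) := by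
  classical
  have h := (isCompact_channelUnits (a := ea) (b := a)).image
    ((continuous_tensorId_channel (r := eb) N).comp (continuous_tensorId_mapOfUnits ρ.mat))
  convert h using 1
  ext A
  constructor
  · rintro ⟨E, rfl⟩
    refine ⟨fun k l => E.map (single k l 1), ⟨?_, ?_⟩, ?_⟩
    · rw [mapOfUnits_apply_single]; exact E.completelyPositive
    · rw [mapOfUnits_apply_single]; exact E.tracePreserving
    · rw [Function.comp_apply, mapOfUnits_apply_single]; rfl
  · rintro ⟨C, ⟨h1, h2⟩, rfl⟩
    exact ⟨⟨mapOfUnits C, h1, h2⟩, rfl⟩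

theorem assistedHolevo_isMinMax :
    IsGreatest (assistedHolevoValues N ρ) (assistedHolevoInformation N ρ) ∧
      IsMinMax (fun (σ : State (b × eb)) (E : Channel ea a) =>
        relEntropy (encodedOutput N ρ E) σ.mat) (assistedHolevoInformation N ρ) := by
  have hpsd := posSemidef_encodedOutput N ρ
  have hK : IsCompact (Set.range fun E : Channel ea a =>
      (encodedOutput N ρ E, negEntropy (encodedOutput N ρ E))) := by
    have h := (isCompact_range_encodedOutput N ρ).image_of_continuousOn
      (f := fun A => (A, negEntropy A)) ?_
    · rw [← Set.range_comp] at h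
      exact h
    · refine continuousOn_id.prodMk (continuousOn_negEntropy.mono ?_)
      rintro _ ⟨E, rfl⟩
      exact (hpsd E).1
  obtain ⟨M, hM, hMM⟩ := ensemble_isMinMax (T := Channel ea a) hpsd (trace_encodedOutput N ρ) hK
  have hval : assistedHolevoValues N ρ =
      ensembleValues (encodedOutput N ρ) fun E => negEntropy (encodedOutput N ρ E) := by
    ext v
    refine exists_congr fun k => exists_congr fun p => exists_congr fun t =>
      and_congr_right fun hp => ?_
    rw [mutualInformation_cqState hp.1 (fun x => hpsd (t x)) fun x => trace_encodedOutput N ρ (t x)]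
  have hI : assistedHolevoInformation N ρ = M := by
    rw [assistedHolevoInformation, hval]; exact hM.isLUB.sSup_eq
  rw [hI, hval]
  refine ⟨hM, ?_⟩
  simpa only [sub_self, EReal.coe_zero, zero_add] using hMM

theorem continuous_marginalFst {m : Type*} {n : Type*} [Fintype n] :
    Continuous (marginalFst : Matrix (m × n) (m × n) ℂ → Matrix m m ℂ) :=
  continuous_pi fun _ => continuous_pi fun _ => continuous_finsetSum _ fun _ _ =>
    continuous_apply_apply _ _

theorem assistedMutual_isMinMax :
    IsGreatest (assistedMutualValues N ρ) (assistedMutualInformation N ρ) ∧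
      IsMinMax (fun (σ : State b) (E : Channel ea a) =>
        relEntropy (encodedOutput N ρ E) (σ.mat ⊗ₖ marginalSnd ρ.mat))
        (assistedMutualInformation N ρ) := by
  classical
  have hpsd := posSemidef_encodedOutput N ρ
  have hK : IsCompact (Set.range fun E : Channel ea a =>
      (marginalFst (encodedOutput N ρ E),
        negEntropy (encodedOutput N ρ E) - negEntropy (marginalSnd ρ.mat))) := by
    have h := (isCompact_range_encodedOutput N ρ).image_of_continuousOn
      (f := fun A => (marginalFst A, negEntropy A - negEntropy (marginalSnd ρ.mat))) ?_
    · rw [← Set.range_comp] at h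
      exact h
    · refine continuous_marginalFst.continuousOn.prodMk
        ((continuousOn_negEntropy.mono ?_).sub continuousOn_const)
      rintro _ ⟨E, rfl⟩
      exact (hpsd E).1
  obtain ⟨M, hM, hMM⟩ := ensemble_isMinMax (T := Channel ea a)
    (fun E => posSemidef_marginalFst (hpsd E))
    (fun E => (trace_marginalFst _).trans (trace_encodedOutput N ρ E)) hK
  have hval : assistedMutualValues N ρ =
      ensembleValues (fun E => marginalFst (encodedOutput N ρ E))
        fun E => negEntropy (encodedOutput N ρ E) - negEntropy (marginalSnd ρ.mat) := by
    ext v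
    refine exists_congr fun k => exists_congr fun p => exists_congr fun t =>
      and_congr_right fun hp => ?_
    rw [mutualInformation_regroup_cqState hp (fun x => hpsd (t x))
      (fun x => trace_encodedOutput N ρ (t x)) (fun x => marginalSnd_encodedOutput N ρ (t x))
      (posSemidef_marginalSnd ρ.posSemidef) ((trace_marginalSnd _).trans ρ.trace_eq_one)]
  have hI : assistedMutualInformation N ρ = M := by
    rw [assistedMutualInformation, hval]; exact hM.isLUB.sSup_eq
  rw [hI, hval]
  refine ⟨hM, ?_⟩
  convert hMM using 3 with σ E
  -- Encoding never changes the marginal on E_B, so the E_B relative entropy vanishes and the payoff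
  -- is I(ω) + D(ω_B‖σ).
  have h := relEntropy_kronecker_marginalSnd (hpsd E) σ.posSemidef
  rw [marginalSnd_encodedOutput] at h
  rw [h, mutualInfoReal, marginalSnd_encodedOutput]
  congr 2
  ring

end Assisted

/-! ### Monotonicity of the Holevo quantity, and the Choi matrix. -/

section ChannelMutualInformation

variable {m : Type u} {n : Type v} [Fintype m] [DecidableEq m] [Fintype n] [DecidableEq n]
  {ι : Type w} [Fintype ι] {V : ι → Matrix n m ℂ}

theorem krausMap_real_smul (r : ℝ) (A : Matrix m m ℂ) :
    krausMap V (r • A) = r • krausMap V A := by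
  simp only [krausMap, Matrix.mul_smul, Matrix.smul_mul, Finset.smul_sum]

theorem krausMap_sum {κ : Type*} (s : Finset κ) (A : κ → Matrix m m ℂ) :
    krausMap V (∑ i ∈ s, A i) = ∑ i ∈ s, krausMap V (A i) := by
  simp only [krausMap, Matrix.mul_sum, Matrix.sum_mul]
  exact Finset.sum_comm

theorem continuous_krausMap : Continuous (krausMap V) := by
  unfold krausMap
  exact continuous_finsetSum _ fun k _ =>
    (continuous_const.matrix_mul continuous_id).matrix_mul continuous_const

theorem suppLE_sum_smul {k : ℕ} {p : Fin k → ℝ} (hp : ∀ x, 0 ≤ p x) {P : Fin k → Matrix m m ℂ}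
    (hP : ∀ x, (P x).PosSemidef) {x : Fin k} (hx : 0 < p x) :
    SuppLE (P x) (∑ y, p y • P y) := by
  intro v hv
  rw [← Finset.add_sum_erase _ _ (Finset.mem_univ x)] at hv
  have := SuppLE.add_right (posSemidef_real_smul (hP x) hx.le)
    (posSemidef_sum _ fun y _ => posSemidef_real_smul (hP y) (hp y)) v hv
  rw [smul_mulVec] at this
  exact (smul_eq_zero.1 this).resolve_left hx.ne'

/-- A quantum channel does not increase the Holevo quantity of an ensemble. -/
theorem sum_negEntropy_krausMap_le (hV : ∑ k, (V k)ᴴ * V k = 1) {k : ℕ} {p : Fin k → ℝ}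
    (hp : ∀ x, 0 ≤ p x) {P : Fin k → Matrix m m ℂ} (hP : ∀ x, (P x).PosSemidef) :
    ∑ x, p x * negEntropy (krausMap V (P x)) - negEntropy (krausMap V (∑ x, p x • P x)) ≤
      ∑ x, p x * negEntropy (P x) - negEntropy (∑ x, p x • P x) := by
  have hQ : (∑ x, p x • P x).PosSemidef :=
    posSemidef_sum _ fun y _ => posSemidef_real_smul (hP y) (hp y)
  have hΦ : krausMap V (∑ x, p x • P x) = ∑ x, p x • krausMap V (P x) := by
    rw [krausMap_sum]
    exact Finset.sum_congr rfl fun x _ => krausMap_real_smul _ _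
  -- Expanding the first argument only makes each side a weighted sum of relative entropies to the
  -- average; monotonicity is then applied termwise. Terms of zero probability are set apart, as
  -- their supports need not be included.
  have e1 : negEntropy (krausMap V (∑ x, p x • P x)) =
      ∑ x, p x * trLog (krausMap V (P x)) (krausMap V (∑ x, p x • P x)) := by
    conv_lhs => rw [negEntropy]
    conv_lhs => enter [1]; rw [hΦ]
    rw [trLog_sum_left]
    exact Finset.sum_congr rfl fun x _ => trLog_smul_left _ _ _
  have e2 : negEntropy (∑ x, p x • P x) = ∑ x, p x * trLog (P x) (∑ x, p x • P x) := by
    rw [negEntropy, trLog_sum_left]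
    exact Finset.sum_congr rfl fun x _ => trLog_smul_left _ _ _
  rw [e1, e2, ← Finset.sum_sub_distrib, ← Finset.sum_sub_distrib]
  refine Finset.sum_le_sum fun x _ => ?_
  rcases (hp x).eq_or_lt with hx | hx
  · simp [← hx]
  · have hs' : SuppLE (krausMap V (P x)) (krausMap V (∑ x, p x • P x)) := by
      rw [hΦ]
      exact suppLE_sum_smul hp (fun y => posSemidef_krausMap (hP y)) hx
    have := relEntropy_krausMap_le hV (hP x) hQ (suppLE_sum_smul hp hP hx) hs'
    have := mul_le_mul_of_nonneg_left this hx.le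
    linarith

theorem exists_eq_conjTranspose_mul_self {A : Matrix n n ℂ} (hA : A.PosSemidef) :
    ∃ B : Matrix n n ℂ, A = Bᴴ * B := by
  obtain ⟨U, d, h1, h2, rfl, hd⟩ := exists_unitary_rdiag_nonneg hA
  refine ⟨rdiag (fun i => √(d i)) * Uᴴ, ?_⟩
  have h : (rdiag fun i => √(d i))ᴴ * rdiag (fun i => √(d i)) = rdiag d := by
    rw [diagonal_conjTranspose, diagonal_mul_diagonal]
    congr 1
    funext i
    simp only [Pi.star_apply, Complex.star_def, Complex.conj_ofReal]
    rw [← Complex.ofReal_mul, Real.mul_self_sqrt (hd i)]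
  rw [← h, conjTranspose_mul, conjTranspose_conjTranspose]
  simp only [Matrix.mul_assoc]

variable {a : Type u} {b : Type v} [Fintype a] [DecidableEq a] [Fintype b] [DecidableEq b]
  (N : Channel a b)

/-- The Choi matrix of a channel from `A` to `B`, on `B ⊗ A`. -/
def choi : Matrix (b × a) (b × a) ℂ := fun p q => N.map (single p.2 q.2 1) p.1 q.1

theorem posSemidef_choi : (choi N).PosSemidef := by
  have h := posSemidef_tensorId N
    (posSemidef_vecMulVec_self_star fun t : a × a => if t.1 = t.2 then (1 : ℂ) else 0)
  convert h using 1
  ext p q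
  rw [tensorId_maximallyEntangled]
  rfl

theorem tensorId_vecMulVec (ψ : a × a → ℂ) :
    tensorId N.map (vecMulVec ψ (star ψ)) =
      ((1 : Matrix b b ℂ) ⊗ₖ (of fun i j => ψ (i, j))ᵀ) * choi N *
        ((1 : Matrix b b ℂ) ⊗ₖ (of fun i j => ψ (i, j))ᵀ)ᴴ := by
  ext p q
  have h := congrFun (congrFun (congrArg (fun L => L (fun i i' =>
    vecMulVec ψ (star ψ) (i, p.2) (i', q.2))) (mapOfUnits_apply_single N.map)) p.1) q.1
  rw [tensorId, ← h]
  simp only [mapOfUnits, LinearMap.coe_mk, AddHom.coe_mk, Matrix.sum_apply, Matrix.smul_apply,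
    mul_apply, Fintype.sum_prod_type, kroneckerMap_apply, conjTranspose_apply, transpose_apply,
    of_apply, one_apply, choi, vecMulVec_apply, Pi.star_apply, smul_eq_mul, Finset.sum_mul, ite_mul,
    one_mul, zero_mul, mul_ite, mul_zero, apply_ite star, star_zero]
  rw [Finset.sum_comm]
  simp only [Finset.sum_ite_irrel, Finset.sum_const_zero, Finset.sum_ite_eq,
    Finset.mem_univ, if_true]
  refine Finset.sum_congr rfl fun i _ => Finset.sum_congr rfl fun j _ => ?_
  ring

end ChannelMutualInformation

/-! ### The environment of a channel and its mutual information. -/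

section Purifications

variable {a : Type u} {b : Type v} [Fintype a] [DecidableEq a] [Fintype b] [DecidableEq b]
  (N : Channel a b)

/-- The Kraus operators read off from a factor `B` of the Choi matrix. -/
def choiKraus (B : Matrix (b × a) (b × a) ℂ) (β : b) : Matrix (b × a) a ℂ :=
  of fun k i => B k (β, i)

theorem krausMap_choiKraus (B : Matrix (b × a) (b × a) ℂ) (P : Matrix a a ℂ) :
    krausMap (choiKraus B) P = B * ((1 : Matrix b b ℂ) ⊗ₖ P) * Bᴴ := by
  ext p q
  simp only [krausMap, choiKraus, Matrix.sum_apply, mul_apply, conjTranspose_apply, of_apply,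
    Fintype.sum_prod_type, kroneckerMap_apply, one_apply, ite_mul, one_mul, zero_mul, mul_ite,
    mul_zero, Finset.sum_ite_irrel, Finset.sum_const_zero]
  refine Finset.sum_congr rfl fun β _ => Finset.sum_congr rfl fun i _ => ?_
  congr 1
  simp

/-- The (i, j) entry of the sum is the trace of N applied to a matrix unit, so trace preservation of
N makes the environment map trace preserving as well. -/
theorem sum_choiKraus {B : Matrix (b × a) (b × a) ℂ} (hB : choi N = Bᴴ * B) :
    ∑ β, (choiKraus B β)ᴴ * choiKraus B β = 1 := by
  ext i j
  have h (β : b) : ((choiKraus B β)ᴴ * choiKraus B β) i j = N.map (single i j 1) β β := by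
    change _ = choi N (β, i) (β, j)
    rw [hB]
    rfl
  rw [Matrix.sum_apply]
  simp only [h]
  refine (N.tracePreserving (single i j 1)).trans ?_
  by_cases hij : i = j
  · subst hij; simp
  · simp [hij, trace_single_eq_of_ne]

/-- `-S(E) + S(A)` for the environment `E` of the channel with Choi matrix `Bᴴ B`. -/
def coherentTerm (B : Matrix (b × a) (b × a) ℂ) (ρ : Matrix a a ℂ) : ℝ :=
  negEntropy (krausMap (choiKraus B) ρᵀ) - negEntropy ρ

theorem marginals_of_isPurification {φ : State (a × a)} {ρ : State a} (h : IsPurification φ ρ) :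
    ∃ Ψ : Matrix a a ℂ, φ.mat = vecMulVec (fun t => Ψ t.1 t.2) (star fun t => Ψ t.1 t.2) ∧
      Ψ * Ψᴴ = ρ.mat ∧ marginalSnd φ.mat = Ψᵀ * (Ψᵀ)ᴴ := by
  obtain ⟨⟨ψ, hψ⟩, hm⟩ := h
  refine ⟨of fun i j => ψ (i, j), hψ, ?_, ?_⟩
  · rw [← hm, hψ]
    ext i j
    simp [marginalFst, mul_apply, vecMulVec_apply]
  · rw [hψ]
    ext i j
    simp [marginalSnd, mul_apply, vecMulVec_apply]

/-- Writing the purifying vector as a matrix Ψ and the Choi matrix as BᴴB, the output is YYᴴ with Y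
= (1 ⊗ Ψᵀ)Bᴴ. It has the spectrum of YᴴY = B(1 ⊗ ρᵀ)Bᴴ, the environment state. Likewise S(A') =
S(A), so only ρ enters and the purification is immaterial. -/
theorem mutualInfoReal_of_isPurification {B : Matrix (b × a) (b × a) ℂ} (hB : choi N = Bᴴ * B)
    {φ : State (a × a)} {ρ : State a} (h : IsPurification φ ρ) :
    mutualInfoReal (tensorId N.map φ.mat) = coherentTerm B ρ.mat - negEntropy (N.map ρ.mat) := by
  obtain ⟨Ψ, hφ, hρ, hS⟩ := marginals_of_isPurification h
  have hT : (Ψᵀ)ᴴ * Ψᵀ = ρ.matᵀ := by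
    rw [← hρ, transpose_mul]; rfl
  have h1 : negEntropy (marginalSnd φ.mat) = negEntropy ρ.mat := by
    rw [hS, negEntropy_mul_conjTranspose_comm, hT, negEntropy_transpose ρ.posSemidef.1]
  have h2 : negEntropy (tensorId N.map φ.mat) = negEntropy (krausMap (choiKraus B) ρ.matᵀ) := by
    rw [hφ, tensorId_vecMulVec, hB]
    change negEntropy (((1 : Matrix b b ℂ) ⊗ₖ Ψᵀ) * (Bᴴ * B) * ((1 : Matrix b b ℂ) ⊗ₖ Ψᵀ)ᴴ) = _
    have e1 : ((1 : Matrix b b ℂ) ⊗ₖ Ψᵀ) * (Bᴴ * B) * ((1 : Matrix b b ℂ) ⊗ₖ Ψᵀ)ᴴ =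
        (((1 : Matrix b b ℂ) ⊗ₖ Ψᵀ) * Bᴴ) * (((1 : Matrix b b ℂ) ⊗ₖ Ψᵀ) * Bᴴ)ᴴ := by
      rw [conjTranspose_mul, conjTranspose_conjTranspose]
      simp only [Matrix.mul_assoc]
    rw [e1, negEntropy_mul_conjTranspose_comm, krausMap_choiKraus, ← hT, conjTranspose_mul,
      conjTranspose_conjTranspose]
    congr 1
    rw [← Matrix.one_mul (1 : Matrix b b ℂ), mul_kronecker_mul, Matrix.one_mul,
      conjTranspose_kronecker, conjTranspose_one]
    simp only [Matrix.mul_assoc]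
  rw [mutualInfoReal, marginalFst_tensorId, marginalSnd_tensorId, h1, h2, h.2, coherentTerm]
  ring

/-- Concavity of S(A) - S(E) is the statement that the Holevo quantity of an ensemble does not grow
on passing to the environment. -/
theorem sum_coherentTerm_le {B : Matrix (b × a) (b × a) ℂ} (hB : choi N = Bᴴ * B) {k : ℕ}
    {p : Fin k → ℝ} (hp : ∀ x, 0 ≤ p x) {P : Fin k → Matrix a a ℂ} (hP : ∀ x, (P x).PosSemidef) :
    ∑ x, p x * coherentTerm B (P x) ≤ coherentTerm B (∑ x, p x • P x) := by
  have h := sum_negEntropy_krausMap_le (sum_choiKraus N hB) hp fun x => (hP x).transpose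
  have hT : ∑ x, p x • (P x)ᵀ = (∑ x, p x • P x)ᵀ := by
    rw [transpose_sum]; rfl
  have hQ : (∑ x, p x • P x).PosSemidef :=
    posSemidef_sum _ fun y _ => posSemidef_real_smul (hP y) (hp y)
  simp only [hT, negEntropy_transpose hQ.1, negEntropy_transpose (hP _).1] at h
  simp only [coherentTerm, mul_sub, Finset.sum_sub_distrib]
  linarith

theorem continuousOn_coherentTerm (B : Matrix (b × a) (b × a) ℂ) :
    ContinuousOn (coherentTerm B) {A | A.PosSemidef} := by
  refine (continuousOn_negEntropy.comp
    (continuous_krausMap.comp continuous_id.matrix_transpose).continuousOn ?_).sub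
    (continuousOn_negEntropy.mono fun A hA => PosSemidef.isHermitian hA)
  exact fun A hA => (posSemidef_krausMap (PosSemidef.transpose hA)).1

/-- M is chosen before φ, which expresses independence of the purification. -/
theorem exists_forall_purification_isMinMax [Nonempty a] :
    ∃ M : ℝ, ∀ φ : State a → State (a × a), (∀ ρ, IsPurification (φ ρ) ρ) →
      IsGreatest (Set.range fun ρ => mutualInformation (tensorId N.map (φ ρ).mat)) M ∧
      IsMinMax (fun (σ : State b) (ρ : State a) =>
        relEntropy (tensorId N.map (φ ρ).mat) (σ.mat ⊗ₖ marginalSnd (φ ρ).mat)) M := by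
  obtain ⟨B, hB⟩ := exists_eq_conjTranspose_mul_self (posSemidef_choi N)
  have hpsd (ρ : State a) : (N.map ρ.mat).PosSemidef := posSemidef_map N ρ.posSemidef
  have hK : IsCompact (Set.range fun ρ : State a => (N.map ρ.mat, coherentTerm B ρ.mat)) := by
    have h := (isCompact_states (n := a)).image_of_continuousOn
      (f := fun A => (N.map A, coherentTerm B A))
      ((continuous_channel_map N).continuousOn.prodMk
        ((continuousOn_coherentTerm B).mono fun A hA => hA.1))
    rw [← range_state_mat, ← Set.range_comp] at h
    exact h
  obtain ⟨M, ⟨hM, hMub⟩, hMM⟩ := ensemble_isMinMax (T := State a) hpsd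
    (fun ρ => (N.tracePreserving _).trans ρ.trace_eq_one) hK
  refine ⟨M, fun φ hφ => ?_⟩
  have hφpsd (ρ : State a) := posSemidef_tensorId N (φ ρ).posSemidef
  have hI (ρ : State a) : mutualInformation (tensorId N.map (φ ρ).mat) =
      ((coherentTerm B ρ.mat - negEntropy (N.map ρ.mat) : ℝ) : EReal) := by
    rw [mutualInformation_eq (hφpsd ρ), mutualInfoReal_of_isPurification N hB (hφ ρ)]
  have hub (ρ : State a) :
      ((coherentTerm B ρ.mat - negEntropy (N.map ρ.mat) : ℝ) : EReal) ≤ M := by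
    refine hMub ⟨1, fun _ => 1, fun _ => ρ, ⟨fun _ => zero_le_one, by simp⟩, ?_⟩
    simp
  refine ⟨⟨?_, ?_⟩, ?_⟩
  · obtain ⟨k, p, t, hp, hv⟩ := hM
    -- An optimal ensemble is replaced by its average state: the entropy of the B output depends
    -- only on the average, and the coherent term is concave.
    let ρ : State a := ⟨∑ x, p x • (t x).mat,
      posSemidef_sum _ fun y _ => posSemidef_real_smul (t y).posSemidef (hp.1 y), by
        rw [trace_sum]
        simp only [trace_smul, (t _).trace_eq_one, ← Finset.sum_smul, hp.2, one_smul]⟩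
    refine ⟨ρ, ?_⟩
    simp only
    rw [hI]
    refine le_antisymm (hub ρ) ?_
    rw [hv, EReal.coe_le_coe_iff]
    have h1 := sum_coherentTerm_le N hB hp.1 fun x => (t x).posSemidef
    have h2 : N.map ρ.mat = ∑ x, (p x : ℂ) • N.map (t x).mat := by
      change N.map (∑ x, p x • (t x).mat) = _
      rw [map_sum]
      refine Finset.sum_congr rfl fun x _ => ?_
      rw [← map_smul, Complex.coe_smul]
    rw [h2]
    exact sub_le_sub_right h1 _
  · rintro _ ⟨ρ, rfl⟩
    simp only
    rw [hI]
    exact hub ρ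
  · convert hMM using 3 with σ ρ
    have h := relEntropy_kronecker_marginalSnd (hφpsd ρ) σ.posSemidef
    rw [marginalSnd_tensorId] at h
    rw [h, mutualInfoReal_of_isPurification N hB (hφ ρ), marginalFst_tensorId, (hφ ρ).2]

theorem channelMutualInformation_isMinMax [Nonempty a] (φ : State a → State (a × a))
    (hφ : ∀ ρ, IsPurification (φ ρ) ρ) :
    IsGreatest (Set.range fun ρ => mutualInformation (tensorId N.map (φ ρ).mat))
        (channelMutualInformation N) ∧
      IsMinMax (fun (σ : State b) (ρ : State a) =>
        relEntropy (tensorId N.map (φ ρ).mat) (σ.mat ⊗ₖ marginalSnd (φ ρ).mat))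
        (channelMutualInformation N) := by
  obtain ⟨M, hM⟩ := exists_forall_purification_isMinMax N
  have h : channelMutualInformation N = M :=
    (hM purify isPurification_purify).1.isLUB.sSup_eq
  rw [h]
  exact hM φ hφ

end Purifications

end QInfo

end

theorem mainTheorem10 {a b ea eb : Type*}
    [Fintype a] [DecidableEq a] [Nonempty a] [Fintype b] [DecidableEq b]
    [Fintype ea] [Fintype eb] [DecidableEq eb]
    (N : QInfo.Channel a b) (ρ : QInfo.State (ea × eb)) :
    (IsGreatest (QInfo.holevoValues N) (QInfo.holevoInformation N) ∧
      QInfo.IsMinMax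
        (fun (σ : QInfo.State b) (ρA : QInfo.State a) =>
          QInfo.relEntropy (N.map ρA.mat) σ.mat)
        (QInfo.holevoInformation N)) ∧
    (∀ φ : QInfo.State a → QInfo.State (a × a), (∀ ρA, QInfo.IsPurification (φ ρA) ρA) →
      IsGreatest
        (Set.range fun ρA => QInfo.mutualInformation (QInfo.tensorId N.map (φ ρA).mat))
        (QInfo.channelMutualInformation N) ∧
      QInfo.IsMinMax
        (fun (σ : QInfo.State b) (ρA : QInfo.State a) =>
          QInfo.relEntropy (QInfo.tensorId N.map (φ ρA).mat)
            (σ.mat ⊗ₖ QInfo.marginalSnd (φ ρA).mat))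
        (QInfo.channelMutualInformation N)) ∧
    (IsGreatest (QInfo.assistedHolevoValues N ρ) (QInfo.assistedHolevoInformation N ρ) ∧
      QInfo.IsMinMax
        (fun (σ : QInfo.State (b × eb)) (E : QInfo.Channel ea a) =>
          QInfo.relEntropy (QInfo.encodedOutput N ρ E) σ.mat)
        (QInfo.assistedHolevoInformation N ρ)) ∧
    (IsGreatest (QInfo.assistedMutualValues N ρ) (QInfo.assistedMutualInformation N ρ) ∧
      QInfo.IsMinMax
        (fun (σ : QInfo.State b) (E : QInfo.Channel ea a) =>
          QInfo.relEntropy (QInfo.encodedOutput N ρ E)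
            (σ.mat ⊗ₖ QInfo.marginalSnd ρ.mat))
        (QInfo.assistedMutualInformation N ρ)) :=
  ⟨QInfo.holevo_isMinMax N, QInfo.channelMutualInformation_isMinMax N,
    QInfo.assistedHolevo_isMinMax N ρ, QInfo.assistedMutual_isMinMax N ρ⟩
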